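/- Let $GF(q^w)/GF(q)$ be an extension of finite fields of degree $w\ge 1$, let $V$ be a vector space of dimension $A\ge 1$ over $GF(q^w)$, let $\alpha\in GF(q^w)^*$ and let $L:GF(q^w)\to GF(q)$, $L(x)=\mathrm{Tr}_{GF(q^w)/GF(q)}(\alpha x)$. For a quadratic form $Q:V\to GF(q^w)$ or a form $\beta:V\times V\to GF(q^w)$, the composites $LQ$ and $L\beta$ are forms on $V$ regarded as an $Aw$-dimensional space over $GF(q)$. A quadratic form $Q$ with polar form $f_Q$ is non-degenerate if $Q(u)=0$ and $f_Q(u,v)=0$ for all $v$ imply $u=0$; a non-degenerate form in dimension $n$ has type $O^+(n)$, $O^-(n)$ or $O(n)$ if its Witt index (largest dimension of a totally singular subspace) is $n/2$, $n/2-1$ or $(n-1)/2$ respectively. A germ of $Q$ is an anisotropic subspace $U$ with $V=R\perp U$, $R$ an orthogonal sum of hyperbolic lines. A $\sigma$-sesquilinear form is hermitian if $\sigma$ is an automorphism of order $2$ and $\beta(u,v)=\sigma(\beta(v,u))$; pseudo-symplectic means characteristic $2$, symmetric, non-alternating and non-degenerate; atypical means sesquilinear but neither alternating, symmetric nor hermitian.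 $E^{*2}$ denotes the group of nonzero squares of a field $E$. (1) Quadratic forms. Every $GF(q^w)$-linear isometry of $Q$ is an isometry of $LQ$. Moreover: - if $Q$ has type $O^+(A,q^w)$, then $LQ$ has type $O^+(Aw,q)$, so $O^+(A,q^w)\le O^+(Aw,q)$; - if $Q$ has type $O^-(A,q^w)$, then $LQ$ has type $O^-(Aw,q)$, so $O^-(A,q^w)\le O^-(Aw,q)$; - if $Q$ has type $O(A,q^w)$, then $Q$ has a germ, every germ $U$ is a line and $Q|_U(x)=\gamma x^2$ in a suitable coordinate, with some $\gamma\in GF(q^w)^*$; and, for any germ and any such $\gamma$: - if $q$ is even and $w>1$, then $LQ$ is degenerate; - if $q$ and $w$ are odd, then $LQ$ has type $O(Aw,q)$, so $O(A,q^w)\le O(Aw,q)$; - if $q$ is odd and $w$ is even, then with $E=GF(q^{w/2})$, $LQ$ has type $O^+(Aw,q)$ (so $O(A,q^w)\le O^+(Aw,q)$) if and only if $(\alpha\gamma)^{-2}\in E\setminus E^{*2}$ or $(\alpha\gamma)^{q^{w/2}+1}\not\equiv -1 \pmod{E^{*2}}$; - if $q$ is odd and $w$ is even, then $LQ$ has type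 $O^-(Aw,q)$ (so $O(A,q^w)\le O^-(Aw,q)$) if and only if $(\alpha\gamma)^{-2}\notin E\setminus E^{*2}$ and $(\alpha\gamma)^{q^{w/2}+1}\equiv -1 \pmod{E^{*2}}$. (2) Sesquilinear forms. Every $GF(q^w)$-linear isometry of $\beta$ is an isometry of $L\beta$. If $q$ is odd and $\beta$ is symmetric and non-degenerate, then $L\beta$ is symmetric, $Q(v)=\frac12\beta(v,v)$ is a non-degenerate quadratic form, and the type of $L\beta$, i.e. the type of the quadratic form $\frac12 L\beta(v,v)$, is given by (1) applied to $Q$. If $\beta$ is non-degenerate and hermitian with automorphism $\sigma$, then: - for $w$ odd, $L\beta$ is non-degenerate hermitian if and only if $\sigma(\alpha)=\alpha$, and then $U(A,q^w)\le U(Aw,q)$; it is atypical if and only if $\sigma(\alpha)\ne\alpha$; - for $w$ even and $q$ even, $L\beta$ is non-degenerate alternating if and only if $\sigma(\alpha)=\alpha$, and then $U(A,q^w)\le Sp(Aw,q)$; - for $w$ even and $q$ odd, $L\beta$ is non-degenerate alternating if and only if $\sigma(\alpha)=-\alpha$, and then $U(A,q^w)\le Sp(Aw,q)$; - for $w$ even,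 $L\beta$ is atypical if and only if $\sigma(\alpha)\ne\pm\alpha$; - for $w$ even and $q$ odd, $L\beta$ is symmetric of type $O^+(Aw,q)$ if and only if $A$ is even and $\sigma(\alpha)=\alpha$, and then $U(A,q^w)\le O^+(Aw,q)$; it is symmetric of type $O^-(Aw,q)$ if and only if $A$ is odd and $\sigma(\alpha)=\alpha$, and then $U(A,q^w)\le O^-(Aw,q)$. If $\beta$ is non-degenerate alternating, so is $L\beta$, and $Sp(A,q^w)\le Sp(Aw,q)$. If $q$ is even and $\beta$ is pseudo-symplectic, so is $L\beta$. -/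

import Mathlib

open Module

section QuadraticForms

variable {k V : Type*} [Field k] [AddCommGroup V] [Module k V]

/-- A subspace on which the quadratic form `Q` vanishes identically. -/
def IsTotallySingular (Q : QuadraticForm k V) (W : Submodule k V) : Prop :=
  ∀ v ∈ W, Q v = 0

/-- The Witt index: the largest dimension of a totally singular subspace (the set below is
bounded when `V` is finite-dimensional). -/
noncomputable def wittIndex (Q : QuadraticForm k V) : ℕ :=
  sSup {d : ℕ | ∃ W : Submodule k V, IsTotallySingular Q W ∧ finrank k W = d}

/-- `Q` is degenerate: some nonzero `u` has `Q u = 0` and is orthogonal to all of `V` with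
respect to the polar form of `Q`. -/
def IsDegenerateQuad (Q : QuadraticForm k V) : Prop := Q.radical ≠ ⊥

/-- `Q` is of type `O⁺(n, k)`: non-degenerate, of dimension `n` and Witt index `n / 2`. -/
def IsOPlus (Q : QuadraticForm k V) (n : ℕ) : Prop :=
  Q.radical = ⊥ ∧ finrank k V = n ∧ n = 2 * wittIndex Q

/-- `Q` is of type `O⁻(n, k)`: non-degenerate, of dimension `n` and Witt index `n / 2 - 1`. -/
def IsOMinus (Q : QuadraticForm k V) (n : ℕ) : Prop :=
  Q.radical = ⊥ ∧ finrank k V = n ∧ n = 2 * wittIndex Q + 2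

/-- `Q` is of type `O(n, k)`: non-degenerate, of odd dimension `n` and Witt index
`(n - 1) / 2`. -/
def IsOOdd (Q : QuadraticForm k V) (n : ℕ) : Prop :=
  Q.radical = ⊥ ∧ finrank k V = n ∧ n = 2 * wittIndex Q + 1

/-- `R` is an orthogonal sum of hyperbolic lines: it is spanned by vectors `e i`, `f i` which
form mutually orthogonal hyperbolic pairs. -/
def IsHyperbolicSum (Q : QuadraticForm k V) (R : Submodule k V) : Prop :=
  ∃ (m : ℕ) (e f : Fin m → V),
    Submodule.span k (Set.range e ∪ Set.range f) = R ∧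
    (∀ i, Q (e i) = 0 ∧ Q (f i) = 0) ∧
    (∀ i j, QuadraticMap.polar Q (e i) (e j) = 0 ∧ QuadraticMap.polar Q (f i) (f j) = 0 ∧
      QuadraticMap.polar Q (e i) (f j) = if i = j then 1 else 0)

/-- `U` is a germ of `Q`: it is anisotropic, and `V = R ⊥ U` with `R` an orthogonal sum of
hyperbolic lines. -/
def IsGerm (Q : QuadraticForm k V) (U : Submodule k V) : Prop :=
  (∀ u ∈ U, Q u = 0 → u = 0) ∧
  ∃ R : Submodule k V, IsCompl R U ∧
    (∀ r ∈ R, ∀ u ∈ U, QuadraticMap.polar Q r u = 0) ∧ IsHyperbolicSum Q R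

/-- In a suitable linear coordinate `x` on the line `U`, the restriction of `Q` is
`γ * x ^ 2`. -/
def HasCoefficientOn (Q : QuadraticForm k V) (U : Submodule k V) (γ : k) : Prop :=
  ∃ e : k ≃ₗ[k] U, ∀ x : k, Q (e x : V) = γ * x ^ 2

/-- The isometry group of `Q`. -/
def isomQuad (Q : QuadraticForm k V) : Subgroup (V ≃ₗ[k] V) where
  carrier := {g | ∀ v, Q (g v) = Q v}
  one_mem' := fun _ => rfl
  mul_mem' := by
    intro g h hg hh v
    exact (hg (h v)).trans (hh v)
  inv_mem' := by
    intro g hg v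
    have h := hg (g.symm v)
    rw [LinearEquiv.apply_symm_apply] at h
    exact h.symm

end QuadraticForms

section SesquilinearForms

variable {k V : Type*} [Field k] [AddCommGroup V] [Module k V]

/-- `b` is `σ`-sesquilinear: linear in the first and `σ`-semilinear in the second argument. -/
structure IsSesquilinear (σ : k ≃+* k) (b : V → V → k) : Prop where
  add_left : ∀ x y z, b (x + y) z = b x z + b y z
  smul_left : ∀ (c : k) x y, b (c • x) y = c * b x y
  add_right : ∀ x y z, b x (y + z) = b x y + b x z
  smul_right : ∀ (c : k) x y, b x (c • y) = σ c * b x y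

/-- Non-degeneracy of a form. -/
def FormNondegenerate (b : V → V → k) : Prop := ∀ u, (∀ v, b u v = 0) → u = 0

/-- Alternating bilinear forms. -/
def IsAlternatingForm (b : V → V → k) : Prop :=
  IsSesquilinear (RingEquiv.refl k) b ∧ ∀ x, b x x = 0

/-- Symmetric bilinear forms. -/
def IsSymmetricForm (b : V → V → k) : Prop :=
  IsSesquilinear (RingEquiv.refl k) b ∧ ∀ x y, b x y = b y x

/-- Hermitian forms with respect to the field automorphism `σ` of order 2. -/
def IsHermitianForm (σ : k ≃+* k) (b : V → V → k) : Prop :=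
  IsSesquilinear σ b ∧ σ ≠ RingEquiv.refl k ∧ (∀ a, σ (σ a) = a) ∧ ∀ x y, b x y = σ (b y x)

/-- Atypical: a sesquilinear form which is neither alternating nor symmetric nor hermitian. -/
def IsAtypicalForm (b : V → V → k) : Prop :=
  (∃ σ : k ≃+* k, IsSesquilinear σ b) ∧ ¬ IsAlternatingForm b ∧ ¬ IsSymmetricForm b ∧
    ¬ ∃ σ : k ≃+* k, IsHermitianForm σ b

/-- Type `Sp(n, k)`: a non-degenerate alternating form in dimension `n`. -/
def IsSymplecticType (b : V → V → k) (n : ℕ) : Prop :=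
  IsAlternatingForm b ∧ FormNondegenerate b ∧ finrank k V = n

/-- Type `U(n, k)`: a non-degenerate hermitian form in dimension `n`. -/
def IsUnitaryType (b : V → V → k) (n : ℕ) : Prop :=
  (∃ σ : k ≃+* k, IsHermitianForm σ b) ∧ FormNondegenerate b ∧ finrank k V = n

/-- Pseudo-symplectic: characteristic 2, non-degenerate, symmetric but not alternating. -/
def IsPseudoSymplecticType (b : V → V → k) (n : ℕ) : Prop :=
  (2 : k) = 0 ∧ IsSymmetricForm b ∧ ¬ IsAlternatingForm b ∧ FormNondegenerate b ∧
    finrank k V = n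

/-- The quadratic form attached, in characteristic not 2, to a symmetric form `b`:
`Q v = b v v / 2`. -/
def IsHalfDiagonal (b : V → V → k) (Q : QuadraticForm k V) : Prop :=
  (2 : k) ≠ 0 ∧ ∀ v, Q v = (2 : k)⁻¹ * b v v

/-- A symmetric form in characteristic not 2 whose quadratic form is of type `O⁺(n, k)`. -/
def IsOPlusForm (b : V → V → k) (n : ℕ) : Prop :=
  IsSymmetricForm b ∧ ∃ Q : QuadraticForm k V, IsHalfDiagonal b Q ∧ IsOPlus Q n

/-- A symmetric form in characteristic not 2 whose quadratic form is of type `O⁻(n, k)`. -/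
def IsOMinusForm (b : V → V → k) (n : ℕ) : Prop :=
  IsSymmetricForm b ∧ ∃ Q : QuadraticForm k V, IsHalfDiagonal b Q ∧ IsOMinus Q n

/-- The isometry group of a form. -/
def isomForm (b : V → V → k) : Subgroup (V ≃ₗ[k] V) where
  carrier := {g | ∀ u v, b (g u) (g v) = b u v}
  one_mem' := fun _ _ => rfl
  mul_mem' := by
    intro g h hg hh u v
    exact (hg (h u) (h v)).trans (hh u v)
  inv_mem' := by
    intro g hg u v
    have h := hg (g.symm u) (g.symm v)
    rw [LinearEquiv.apply_symm_apply, LinearEquiv.apply_symm_apply] at h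
    exact h.symm

end SesquilinearForms

section FieldExtension

/-- `GL(V)` over `K` inside `GL(V)` over `F`, by restriction of scalars. -/
def restrictGL (F K V : Type*) [Field F] [Field K] [Algebra F K] [AddCommGroup V] [Module K V]
    [Module F V] [IsScalarTower F K V] : (V ≃ₗ[K] V) →* (V ≃ₗ[F] V) where
  toFun := fun g => g.restrictScalars F
  map_one' := rfl
  map_mul' := fun _ _ => rfl

/-- The `F`-linear map `x ↦ Tr (α * x)` from `K` to `F`. -/
noncomputable def traceMul (F : Type*) {K : Type*} [Field F] [Field K] [Algebra F K] (α : K) :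
    K →ₗ[F] F :=
  Algebra.trace F K ∘ₗ LinearMap.mulLeft F α

/-- `x` is in the subfield `E` but not in the group `E^{*2}` of nonzero squares of `E`. -/
def InWithoutSquares {K : Type*} [Field K] (E : Subfield K) (x : K) : Prop :=
  x ∈ E ∧ ¬ ∃ z ∈ E, z ≠ 0 ∧ x = z ^ 2

/-- `x ≡ y` modulo the group `E^{*2}` of nonzero squares of `E`. -/
def CongrModSquares {K : Type*} [Field K] (E : Subfield K) (x y : K) : Prop :=
  ∃ z ∈ E, z ≠ 0 ∧ x = y * z ^ 2

/-- The classification, row by row, of the `F`-quadratic form `T` obtained from the `K`-quadratic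
form `Q` by composing with `x ↦ Tr (α * x)`; here `q = |F|`, `w = [K : F]`, `A = dim_K V`. -/
structure QuadraticClassification {F K V : Type*} [Field F] [Field K] [Algebra F K]
    [AddCommGroup V] [Module K V] [Module F V] [IsScalarTower F K V]
    (q w A : ℕ) (α : K) (Q : QuadraticForm K V) (T : QuadraticForm F V) : Prop where
  /-- the isometry group of `Q` is a subgroup of the isometry group of `T` -/
  embedding : (isomQuad Q).map (restrictGL F K V) ≤ isomQuad T
  /-- `O⁺(A, q ^ w) ≤ O⁺(A w, q)` -/
  plus : IsOPlus Q A → IsOPlus T (A * w)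
  /-- `O⁻(A, q ^ w) ≤ O⁻(A w, q)` -/
  minus : IsOMinus Q A → IsOMinus T (A * w)
  /-- type `O` has a germ -/
  exists_germ : IsOOdd Q A → ∃ U : Submodule K V, IsGerm Q U
  /-- a germ of a form of type `O` is a line on which `Q` is `γ * x ^ 2` with `γ ≠ 0` -/
  germ_coefficient : IsOOdd Q A → ∀ U : Submodule K V, IsGerm Q U →
    ∃ γ : K, γ ≠ 0 ∧ HasCoefficientOn Q U γ
  /-- type `O`, `q` even, proper extension -/
  odd_degenerate : IsOOdd Q A → Even q → 1 < w → IsDegenerateQuad T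
  /-- `O(A, q ^ w) ≤ O(A w, q)` -/
  odd_odd : IsOOdd Q A → Odd w → Odd q → IsOOdd T (A * w)
  /-- `GF(q ^ (w / 2))` is a subfield of `K` for even `w` -/
  exists_half : Even w → ∃ E : Subfield K, Nat.card E = q ^ (w / 2)
  /-- `O(A, q ^ w) ≤ O⁺(A w, q)`, where `E` is `GF(q ^ (w / 2))` -/
  odd_plus : IsOOdd Q A → Even w → Odd q →
    ∀ E : Subfield K, Nat.card E = q ^ (w / 2) →
    ∀ (U : Submodule K V) (γ : K), IsGerm Q U → HasCoefficientOn Q U γ →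
      (IsOPlus T (A * w) ↔
        (InWithoutSquares E ((α * γ) ^ 2)⁻¹ ∨
          ¬ CongrModSquares E ((α * γ) ^ (q ^ (w / 2) + 1)) (-1)))
  /-- `O(A, q ^ w) ≤ O⁻(A w, q)`, where `E` is `GF(q ^ (w / 2))` -/
  odd_minus : IsOOdd Q A → Even w → Odd q →
    ∀ E : Subfield K, Nat.card E = q ^ (w / 2) →
    ∀ (U : Submodule K V) (γ : K), IsGerm Q U → HasCoefficientOn Q U γ →
      (IsOMinus T (A * w) ↔
        (¬ InWithoutSquares E ((α * γ) ^ 2)⁻¹ ∧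
          CongrModSquares E ((α * γ) ^ (q ^ (w / 2) + 1)) (-1)))

end FieldExtension

/-!
Let `L : K → F` be the functional `x ↦ Tr (α x)` and `T = L ∘ Q`.

*Quadratic forms.* A totally singular `K`-subspace of `Q` is a totally singular `F`-subspace of
`T`, and nondegeneracy of the polar form passes to `T` because `L` does not vanish on a nonzero
`K`-subspace of `K`. That settles type `O⁺` (`IsOPlus.compQuadraticMap'`). For the type `O⁻` one needs to
know that `T` has no larger totally singular subspace, and the invariant used for this is the
Gauss sum `∑ v, ψ (Q v)` with respect to a nontrivial additive character `ψ`
(`quadGaussSum`). Over a finite field a nondegenerate form in even dimension is of type `O⁺` or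
`O⁻`, by the Chevalley-Warning theorem; its Gauss sum is positive in the first case
(`IsOPlus.quadGaussSum_re_pos`) and negative in the second (`IsOMinus.quadGaussSum_re_neg`), for
every `ψ`. Since the Gauss sum of `T` with respect to `ψ` is that of `Q` with respect to the
character `ψ ∘ L`, the type is preserved (`IsOMinus.compQuadraticMap'`).

For type `O` a germ is a line `⟨u⟩`, with `Q u = γ`. In characteristic 2 it is the radical of the
polar form, so `T` is degenerate as soon as `w > 1`; if `q` and `w` are odd then so is the dimension of `T`, and
nondegeneracy suffices. If `q` is odd and `w` even, transfer in two steps through the subfield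
`E` over which `K` has degree 2. Over `E` the form is an orthogonal sum of hyperbolic lines and
the binary form `x ↦ Tr (α γ x²)`, so its type is `O⁺` or `O⁻` according to whether this binary
form is isotropic, which happens unless `-N(α γ)` is a square of `E`
(`exists_trace_mul_sq_eq_zero_iff`). The step from `E` to `F` preserves the type.

*Hermitian forms.* The automorphism `σ` restricts to an automorphism of `F`, which is trivial
exactly if `w` is even (`restrict_eq_refl_iff`), and `L β` determines `α`, so that symmetry
properties of `L β` translate into conditions on `σ α` (`IsHermitianForm.traceMul_eq_iff`). When
`L β` is symmetric, its quadratic form is a transfer from the fixed field `E` of `σ` of the form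
`v ↦ β(v, v)`, whose type over `E` is decided by the parity of the dimension of `V`
(`IsHermitianForm.diagonal_type`).
-/

/-! ### Totally singular subspaces and the Witt index -/

section WittIndex

variable {k V : Type*} [Field k] [AddCommGroup V] [Module k V] {Q : QuadraticForm k V}
  {W : Submodule k V}

theorem mem_radical_iff_polar {u : V} :
    u ∈ Q.radical ↔ Q u = 0 ∧ ∀ v, QuadraticMap.polar Q u v = 0 := by
  change (Q u = 0 ∧ Q.polarBilin u = 0) ↔ _
  simp [LinearMap.ext_iff]

theorem radical_eq_bot_of_polar_nondegenerate (h : FormNondegenerate (QuadraticMap.polar Q)) :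
    Q.radical = ⊥ :=
  (Submodule.eq_bot_iff _).2 fun u hu => h u (mem_radical_iff_polar.1 hu).2

theorem polar_self_eq_two_mul (Q : QuadraticForm k V) (u : V) :
    QuadraticMap.polar Q u u = 2 * Q u := by
  simp [QuadraticMap.polar_self, two_mul]

theorem polar_nondegenerate_of_two_ne_zero (h2 : (2 : k) ≠ 0) (h : Q.radical = ⊥) :
    FormNondegenerate (QuadraticMap.polar Q) := by
  intro u hu
  have hQ : Q u = 0 := by
    have := hu u
    rw [polar_self_eq_two_mul] at this
    exact (mul_eq_zero.1 this).resolve_left h2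
  exact (Submodule.eq_bot_iff _).1 h u (mem_radical_iff_polar.2 ⟨hQ, hu⟩)

/-- The orthogonal complement `W^⊥` of `W` with respect to the polar form of `Q`. -/
def polarPerp (Q : QuadraticForm k V) (W : Submodule k V) : Submodule k V :=
  LinearMap.BilinForm.orthogonal Q.polarBilin W

theorem mem_polarPerp {v : V} :
    v ∈ polarPerp Q W ↔ ∀ w ∈ W, QuadraticMap.polar Q w v = 0 := Iff.rfl

theorem map_add_eq_of_polar_eq_zero {u v : V} (h : QuadraticMap.polar Q u v = 0) :
    Q (u + v) = Q u + Q v := by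
  rw [QuadraticMap.map_add Q, h, add_zero]

theorem IsTotallySingular.polar_eq_zero (hW : IsTotallySingular Q W) {u v : V} (hu : u ∈ W)
    (hv : v ∈ W) : QuadraticMap.polar Q u v = 0 := by
  simp [QuadraticMap.polar, hW _ hu, hW _ hv, hW _ (W.add_mem hu hv)]

theorem IsTotallySingular.le_polarPerp (hW : IsTotallySingular Q W) :
    W ≤ polarPerp Q W :=
  fun _ hv => mem_polarPerp.2 fun _ hw => hW.polar_eq_zero hw hv

theorem isTotallySingular_bot : IsTotallySingular Q ⊥ := by
  intro v hv
  rw [(Submodule.mem_bot k).1 hv, QuadraticMap.map_zero]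

theorem IsTotallySingular.sup (hW : IsTotallySingular Q W) {W' : Submodule k V}
    (hW' : IsTotallySingular Q W') (h : W' ≤ polarPerp Q W) :
    IsTotallySingular Q (W ⊔ W') := by
  intro v hv
  obtain ⟨w, hw, w', hw', rfl⟩ := Submodule.mem_sup.1 hv
  rw [map_add_eq_of_polar_eq_zero (h hw' w hw), hW w hw, hW' w' hw', add_zero]

theorem isTotallySingular_span_singleton {u : V} (hu : Q u = 0) :
    IsTotallySingular Q (Submodule.span k {u}) := by
  intro v hv
  obtain ⟨c, rfl⟩ := Submodule.mem_span_singleton.1 hv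
  rw [QuadraticMap.map_smul, hu, smul_zero]

variable [FiniteDimensional k V]

/-- Only the trivial radical of `Q` is needed, not that of its polar form: a totally singular
subspace meets the radical of the polar form inside the radical of `Q`. -/
theorem IsTotallySingular.finrank_polarPerp (hW : IsTotallySingular Q W) (h : Q.radical = ⊥) :
    finrank k W + finrank k (polarPerp Q W) = finrank k V := by
  rw [polarPerp, LinearMap.BilinForm.finrank_add_finrank_orthogonal']
  have : W ⊓ LinearMap.ker Q.polarBilin = ⊥ := by
    rw [eq_bot_iff, ← h]
    rintro u ⟨hu, hu'⟩
    exact ⟨hW u hu, hu'⟩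
  rw [this, finrank_bot, add_zero]

theorem IsTotallySingular.two_mul_finrank_le (hW : IsTotallySingular Q W) (h : Q.radical = ⊥) :
    2 * finrank k W ≤ finrank k V := by
  have h1 := hW.finrank_polarPerp h
  have h2 := Submodule.finrank_mono hW.le_polarPerp
  omega

theorem bddAbove_finrank_totallySingular (Q : QuadraticForm k V) :
    BddAbove {d : ℕ | ∃ W : Submodule k V, IsTotallySingular Q W ∧ finrank k W = d} := by
  refine ⟨finrank k V, ?_⟩
  rintro d ⟨W, -, rfl⟩
  exact Submodule.finrank_le W

theorem IsTotallySingular.finrank_le_wittIndex (hW : IsTotallySingular Q W) :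
    finrank k W ≤ wittIndex Q :=
  le_csSup (bddAbove_finrank_totallySingular Q) ⟨W, hW, rfl⟩

theorem exists_finrank_eq_wittIndex (Q : QuadraticForm k V) :
    ∃ W : Submodule k V, IsTotallySingular Q W ∧ finrank k W = wittIndex Q :=
  Nat.sSup_mem (s := {d : ℕ | ∃ W : Submodule k V, IsTotallySingular Q W ∧ finrank k W = d})
    ⟨0, ⊥, isTotallySingular_bot, finrank_bot k V⟩ (bddAbove_finrank_totallySingular Q)

theorem two_mul_wittIndex_le (h : Q.radical = ⊥) : 2 * wittIndex Q ≤ finrank k V := by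
  obtain ⟨W, hW, hd⟩ := exists_finrank_eq_wittIndex Q
  exact hd ▸ hW.two_mul_finrank_le h

/-- A totally singular subspace `W` of largest dimension contains all singular vectors of `W^⊥`. -/
theorem IsTotallySingular.mem_of_finrank_eq_wittIndex (hW : IsTotallySingular Q W)
    (hd : finrank k W = wittIndex Q) {v : V} (hv : v ∈ polarPerp Q W)
    (h0 : Q v = 0) : v ∈ W := by
  have hs := hW.sup (isTotallySingular_span_singleton h0)
    ((Submodule.span_singleton_le_iff_mem _ _).2 hv)
  have heq : W = W ⊔ Submodule.span k {v} :=
    Submodule.eq_of_le_of_finrank_le le_sup_left (hs.finrank_le_wittIndex.trans hd.ge)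
  rw [heq]
  exact Submodule.mem_sup_right (Submodule.mem_span_singleton_self v)

theorem isOPlus_of_isTotallySingular (h : Q.radical = ⊥) (hW : IsTotallySingular Q W)
    (hd : finrank k V = 2 * finrank k W) : IsOPlus Q (finrank k V) := by
  refine ⟨h, rfl, ?_⟩
  have := hW.finrank_le_wittIndex
  have := two_mul_wittIndex_le h
  omega

theorem IsOPlus.exists_totallySingular {n : ℕ} (h : IsOPlus Q n) :
    ∃ W : Submodule k V, IsTotallySingular Q W ∧ finrank k V = 2 * finrank k W ∧
      polarPerp Q W = W := by
  obtain ⟨hr, hn, hw⟩ := h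
  obtain ⟨W, hW, hd⟩ := exists_finrank_eq_wittIndex Q
  refine ⟨W, hW, by omega, (Submodule.eq_of_le_of_finrank_le hW.le_polarPerp ?_).symm⟩
  have := hW.finrank_polarPerp hr
  omega

theorem IsOMinus.exists_totallySingular {n : ℕ} (h : IsOMinus Q n) :
    ∃ W : Submodule k V, IsTotallySingular Q W ∧ finrank k V = 2 * finrank k W + 2 ∧
      ∀ v ∈ polarPerp Q W, Q v = 0 → v ∈ W := by
  obtain ⟨hr, hn, hw⟩ := h
  obtain ⟨W, hW, hd⟩ := exists_finrank_eq_wittIndex Q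
  exact ⟨W, hW, by omega, fun v hv h0 => hW.mem_of_finrank_eq_wittIndex hd hv h0⟩

theorem IsOPlus.polar_nondegenerate {n : ℕ} (h : IsOPlus Q n) :
    FormNondegenerate (QuadraticMap.polar Q) := by
  obtain ⟨W, hW, -, hp⟩ := h.exists_totallySingular
  intro u hu
  have huW : u ∈ W := by
    rw [← hp]
    exact mem_polarPerp.2 fun w _ => by rw [QuadraticMap.polar_comm, hu]
  exact (Submodule.eq_bot_iff _).1 h.1 u (mem_radical_iff_polar.2 ⟨hW u huW, hu⟩)

end WittIndex

/-! ### Quadratic forms over finite fields -/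

section FiniteField

variable {k V : Type*} [Field k] [Finite k] [AddCommGroup V] [Module k V] [FiniteDimensional k V]
  {Q : QuadraticForm k V}

/-- By the Chevalley-Warning theorem, applied to `Q` in coordinates. -/
theorem exists_ne_zero_map_eq_zero (Q : QuadraticForm k V) (h : 3 ≤ finrank k V) :
    ∃ v, v ≠ 0 ∧ Q v = 0 := by
  classical
  have := Fintype.ofFinite k
  let b := finBasis k V
  let B := Q.toBilin b
  let p : MvPolynomial (Fin (finrank k V)) k :=
    ∑ i, ∑ j, MvPolynomial.C (B (b i) (b j)) * (MvPolynomial.X i * MvPolynomial.X j)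
  have hp : ∀ x : Fin (finrank k V) → k, MvPolynomial.eval x p = Q (∑ i, x i • b i) := by
    intro x
    have hQ : Q (∑ i, x i • b i) = B (∑ i, x i • b i) (∑ i, x i • b i) := by
      conv_lhs => rw [← QuadraticMap.toQuadraticMap_toBilin Q b]
      rfl
    rw [hQ]
    simp only [p, map_sum, map_mul, MvPolynomial.eval_C, MvPolynomial.eval_X, map_smul,
      LinearMap.sum_apply, LinearMap.smul_apply, smul_eq_mul]
    rw [Finset.sum_comm]
    refine Finset.sum_congr rfl fun i _ => ?_
    rw [Finset.mul_sum]
    refine Finset.sum_congr rfl fun j _ => by ring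
  have hdeg : p.totalDegree < Fintype.card (Fin (finrank k V)) := by
    rw [Fintype.card_fin]
    refine lt_of_le_of_lt (MvPolynomial.totalDegree_finsetSum_le (d := 2) fun i _ =>
      MvPolynomial.totalDegree_finsetSum_le fun j _ => ?_) (show 2 < finrank k V from h)
    refine (MvPolynomial.totalDegree_mul _ _).trans ?_
    refine (Nat.add_le_add_left (MvPolynomial.totalDegree_mul _ _) _).trans ?_
    simp
  have hdvd := char_dvd_card_solutions (ringChar k) hdeg
  have hchar : (ringChar k).Prime := CharP.char_is_prime k _
  have h0 : MvPolynomial.eval (0 : Fin (finrank k V) → k) p = 0 := by rw [hp]; simp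
  have hpos : 0 < Fintype.card {x // MvPolynomial.eval x p = 0} :=
    Fintype.card_pos_iff.2 ⟨⟨0, h0⟩⟩
  have h1 : 1 < Fintype.card {x // MvPolynomial.eval x p = 0} :=
    hchar.one_lt.trans_le (Nat.le_of_dvd hpos hdvd)
  obtain ⟨⟨x, hx⟩, hne⟩ := Fintype.exists_ne_of_one_lt_card h1 ⟨0, h0⟩
  refine ⟨∑ i, x i • b i, fun hs => hne (Subtype.ext (funext fun i => ?_)), (hp x) ▸ hx⟩
  exact Fintype.linearIndependent_iff.1 b.linearIndependent x hs i

theorem finrank_le_two_of_anisotropic {U : Submodule k V} (hU : ∀ u ∈ U, Q u = 0 → u = 0) :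
    finrank k U ≤ 2 := by
  by_contra! h
  obtain ⟨v, hv, h0⟩ := exists_ne_zero_map_eq_zero (Q.comp U.subtype) h
  exact hv (Subtype.ext (hU v v.2 h0))

theorem finrank_le_two_mul_wittIndex_add_two (h : Q.radical = ⊥) :
    finrank k V ≤ 2 * wittIndex Q + 2 := by
  obtain ⟨W, hW, hd⟩ := exists_finrank_eq_wittIndex Q
  -- a complement of `W` inside `W^⊥` is anisotropic
  obtain ⟨C, hC⟩ := exists_isCompl (W.comap (polarPerp Q W).subtype)
  have hCa : ∀ u ∈ C.map (polarPerp Q W).subtype, Q u = 0 → u = 0 := by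
    rintro _ ⟨u, hu, rfl⟩ h0
    have huW : u ∈ W.comap (polarPerp Q W).subtype :=
      hW.mem_of_finrank_eq_wittIndex hd u.2 h0
    have : u = 0 := (Submodule.disjoint_def.1 hC.disjoint) u huW hu
    simp [this]
  have h2 := finrank_le_two_of_anisotropic hCa
  have h3 := Submodule.finrank_add_eq_of_isCompl hC
  have h4 := hW.finrank_polarPerp h
  rw [LinearEquiv.finrank_eq (Submodule.comapSubtypeEquivOfLe hW.le_polarPerp)] at h3
  rw [Submodule.finrank_map_subtype_eq] at h2
  omega

theorem isOPlus_or_isOMinus_of_even (h : Q.radical = ⊥) (hn : Even (finrank k V)) :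
    IsOPlus Q (finrank k V) ∨ IsOMinus Q (finrank k V) := by
  have h1 := finrank_le_two_mul_wittIndex_add_two h
  have h2 := two_mul_wittIndex_le h
  obtain ⟨m, hm⟩ := hn
  by_cases hw : m = wittIndex Q
  · exact Or.inl ⟨h, rfl, by omega⟩
  · exact Or.inr ⟨h, rfl, by omega⟩

theorem isOOdd_of_odd (h : Q.radical = ⊥) (hn : Odd (finrank k V)) :
    IsOOdd Q (finrank k V) := by
  have h1 := finrank_le_two_mul_wittIndex_add_two h
  have h2 := two_mul_wittIndex_le h
  obtain ⟨m, hm⟩ := hn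
  exact ⟨h, rfl, by omega⟩

theorem isSquare_of_two_eq_zero (h2 : (2 : k) = 0) (a : k) : IsSquare a := by
  have := Fintype.ofFinite k
  refine FiniteField.isSquare_of_char_two ?_ a
  have : ringChar k ∣ 2 := (ringChar.spec k 2).1 (by exact_mod_cast h2)
  exact ((Nat.dvd_prime Nat.prime_two).1 this).resolve_left (CharP.ringChar_ne_one)

/-- In characteristic 2 a vector `u` of the radical of the polar form would, every element of `k`
being a square, satisfy `W^⊥ = W + ⟨u⟩` for a maximal totally singular `W`; but `W^⊥ / W` is a
plane. -/
theorem IsOMinus.polar_nondegenerate {n : ℕ} (h : IsOMinus Q n) :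
    FormNondegenerate (QuadraticMap.polar Q) := by
  by_cases h2 : (2 : k) = 0
  swap
  · exact polar_nondegenerate_of_two_ne_zero h2 h.1
  obtain ⟨W, hW, hd, hp⟩ := h.exists_totallySingular
  intro u hu
  by_contra hu0
  have hQu : Q u ≠ 0 := fun h0 =>
    hu0 ((Submodule.eq_bot_iff _).1 h.1 u (mem_radical_iff_polar.2 ⟨h0, hu⟩))
  have hle : polarPerp Q W ≤ W ⊔ Submodule.span k {u} := by
    intro v hv
    obtain ⟨a, ha⟩ := isSquare_of_two_eq_zero h2 (Q v / Q u)
    have hav : Q (a • u + v) = 0 := by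
      rw [map_add_eq_of_polar_eq_zero (by rw [QuadraticMap.polar_smul_left, hu, smul_zero]),
        QuadraticMap.map_smul, ← ha, smul_eq_mul, div_mul_cancel₀ _ hQu, ← two_mul, h2, zero_mul]
    have hmem : a • u + v ∈ W := by
      refine hp _ (Submodule.add_mem _ (Submodule.smul_mem _ a ?_) hv) hav
      exact mem_polarPerp.2 fun w _ => by rw [QuadraticMap.polar_comm, hu]
    rw [show v = (a • u + v) + (-a) • u by module]
    exact Submodule.add_mem_sup hmem
      (Submodule.smul_mem _ _ (Submodule.mem_span_singleton_self u))
  have h1 := Submodule.finrank_mono hle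
  have h3 := Submodule.finrank_add_le_finrank_add_finrank W (Submodule.span k {u})
  have h4 := finrank_span_singleton (K := k) hu0
  have h5 := hW.finrank_polarPerp h.1
  omega

end FiniteField

/-! ### Gauss sums of quadratic forms -/

section GaussSum

variable {k V : Type*} [Field k] [AddCommGroup V] [Module k V]

/-- The Gauss sum `∑ v, ψ (Q v)` of a quadratic form `Q` with respect to an additive character
`ψ` of the field. -/
noncomputable def quadGaussSum [Fintype V] (ψ : AddChar k ℂ) (Q : QuadraticForm k V) : ℂ :=
  ∑ v, ψ (Q v)

/-- The sum of a nontrivial character over the values of a linear functional. -/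
theorem sum_addChar_linearMap [Fintype V] {ψ : AddChar k ℂ} (hψ : ψ ≠ 1) (f : V →ₗ[k] k)
    [Decidable (f = 0)] : ∑ v, ψ (f v) = if f = 0 then (Fintype.card V : ℂ) else 0 := by
  split_ifs with h
  · simp [h]
  · have hne : ψ.compAddMonoidHom f.toAddMonoidHom ≠ 0 := by
      obtain ⟨x, hx⟩ := AddChar.ne_one_iff.1 hψ
      obtain ⟨v, hv⟩ : ∃ v, f v ≠ 0 := by
        by_contra! h0
        exact h (LinearMap.ext h0)
      refine AddChar.ne_zero_iff.2 ⟨(x / f v) • v, ?_⟩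
      simpa [div_mul_cancel₀ x hv] using hx
    exact AddChar.sum_eq_zero_iff_ne_zero.2 hne

theorem exists_addChar_ne_one (k : Type*) [Field k] [Finite k] : ∃ ψ : AddChar k ℂ, ψ ≠ 1 := by
  obtain ⟨ψ, hψ⟩ := (AddChar.exists_apply_ne_zero (a := (1 : k))).2 one_ne_zero
  exact ⟨ψ, AddChar.ne_one_iff.2 ⟨1, hψ⟩⟩

variable [Fintype V] {Q : QuadraticForm k V} {W : Submodule k V} {ψ : AddChar k ℂ}

open Classical in
/-- Averaging over the translates by a totally singular `W` leaves only the terms in `W^⊥`. -/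
theorem IsTotallySingular.quadGaussSum_eq (hW : IsTotallySingular Q W) (hψ : ψ ≠ 1) :
    quadGaussSum ψ Q = ∑ v with v ∈ polarPerp Q W, ψ (Q v) := by
  have hcard : (Fintype.card W : ℂ) ≠ 0 := Nat.cast_ne_zero.2 Fintype.card_ne_zero
  refine mul_left_cancel₀ hcard ?_
  calc (Fintype.card W : ℂ) * quadGaussSum ψ Q
      = ∑ _w : W, ∑ v, ψ (Q v) := by simp [quadGaussSum]
    _ = ∑ w : W, ∑ v, ψ (Q v) * ψ (QuadraticMap.polar Q w v) := by
        refine Finset.sum_congr rfl fun w _ => ?_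
        rw [← Equiv.sum_comp (Equiv.addLeft (w : V))]
        refine Finset.sum_congr rfl fun v _ => ?_
        rw [Equiv.coe_addLeft, QuadraticMap.map_add Q, hW w w.2, zero_add, AddChar.map_add_eq_mul]
    _ = ∑ v, ψ (Q v) * ∑ w : W, ψ ((Q.polarBilin.flip v ∘ₗ W.subtype) w) := by
        rw [Finset.sum_comm]
        simp only [Finset.mul_sum]
        rfl
    _ = ∑ v, if v ∈ polarPerp Q W then (Fintype.card W : ℂ) * ψ (Q v) else 0 := by
        refine Finset.sum_congr rfl fun v _ => ?_
        rw [sum_addChar_linearMap hψ]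
        have : Q.polarBilin.flip v ∘ₗ W.subtype = 0 ↔ v ∈ polarPerp Q W := by
          rw [mem_polarPerp, LinearMap.ext_iff]
          simp
        simp only [this]
        split_ifs <;> ring
    _ = _ := by rw [← Finset.sum_filter, Finset.mul_sum]

theorem normSq_quadGaussSum [Finite k] (h : FormNondegenerate (QuadraticMap.polar Q)) (hψ : ψ ≠ 1) :
    Complex.normSq (quadGaussSum ψ Q) = Fintype.card V := by
  classical
  have : (Complex.normSq (quadGaussSum ψ Q) : ℂ) = Fintype.card V := by
    rw [← Complex.mul_conj, mul_comm]
    calc (starRingEnd ℂ) (quadGaussSum ψ Q) * quadGaussSum ψ Q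
        = ∑ v, ∑ u, ψ (-Q v) * ψ (Q u) := by
          simp only [quadGaussSum, map_sum, AddChar.map_neg_eq_conj, Finset.sum_mul_sum]
      _ = ∑ v, ∑ u, ψ (Q u) * ψ (QuadraticMap.polar Q u v) := by
          refine Finset.sum_congr rfl fun v _ => ?_
          rw [← Equiv.sum_comp (Equiv.addRight v)]
          refine Finset.sum_congr rfl fun u _ => ?_
          rw [Equiv.coe_addRight, QuadraticMap.map_add Q, ← AddChar.map_add_eq_mul,
            ← AddChar.map_add_eq_mul]
          congr 1
          ring
      _ = ∑ u, ψ (Q u) * ∑ v, ψ (Q.polarBilin u v) := by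
          rw [Finset.sum_comm]
          simp only [Finset.mul_sum]
          rfl
      _ = ∑ u : V, if u = 0 then (Fintype.card V : ℂ) else 0 := by
          refine Finset.sum_congr rfl fun u _ => ?_
          rw [sum_addChar_linearMap hψ]
          have : Q.polarBilin u = 0 ↔ u = 0 :=
            ⟨fun hu => h u fun v => LinearMap.congr_fun hu v, fun hu => by simp [hu]⟩
          simp only [this]
          split_ifs with hu <;> simp [hu]
      _ = Fintype.card V := by simp
  exact_mod_cast this

theorem IsOPlus.quadGaussSum_re_pos {n : ℕ} (h : IsOPlus Q n) (hψ : ψ ≠ 1) :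
    0 < (quadGaussSum ψ Q).re := by
  classical
  have : FiniteDimensional k V := .of_finite
  obtain ⟨W, hW, -, hp⟩ := h.exists_totallySingular
  rw [hW.quadGaussSum_eq hψ, hp]
  have : ∑ v with v ∈ W, ψ (Q v) = ∑ v with v ∈ W, (1 : ℂ) :=
    Finset.sum_congr rfl fun v hv => by
      rw [hW v (Finset.mem_filter.1 hv).2, AddChar.map_zero_eq_one]
  rw [this, Finset.sum_const, nsmul_one, Complex.natCast_re, Nat.cast_pos, Finset.card_pos]
  exact ⟨0, by simp⟩

/-- If `W^⊥ / W` is an anisotropic plane, the Gauss sum is negative: the Gauss sums of the forms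
`t Q`, `t ≠ 0`, all have absolute value `√|V|`, and their total is `-(|k| - 1) √|V|`, as
one sees by counting the singular vectors of `W^⊥`. -/
theorem IsTotallySingular.quadGaussSum_re_neg [Finite k] (hW : IsTotallySingular Q W)
    (h : FormNondegenerate (QuadraticMap.polar Q)) (hd : finrank k V = 2 * finrank k W + 2)
    (hp : ∀ v ∈ polarPerp Q W, Q v = 0 → v ∈ W) (hψ : ψ ≠ 1) :
    (quadGaussSum ψ Q).re < 0 := by
  classical
  have : FiniteDimensional k V := .of_finite
  have := Fintype.ofFinite k
  set q := Fintype.card k with hq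
  set S : Finset V := {v | v ∈ polarPerp Q W} with hS
  let P : k → ℂ := fun t => ∑ v ∈ S, ψ (t * Q v)
  have hcW : Fintype.card W = q ^ finrank k W := card_eq_pow_finrank
  have hcV : Fintype.card V = q ^ (2 * finrank k W + 2) := hd ▸ card_eq_pow_finrank
  have hcS : S.card = q ^ (finrank k W + 2) := by
    rw [hS, ← Fintype.card_subtype]
    have h1 := hW.finrank_polarPerp (radical_eq_bot_of_polar_nondegenerate h)
    rw [show finrank k W + 2 = finrank k (polarPerp Q W) by omega]
    exact card_eq_pow_finrank
  have hSW : (S.filter fun v => Q v = 0).card = q ^ finrank k W := by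
    rw [← hcW, Fintype.card_subtype]
    congr 1
    ext v
    simp only [hS, Finset.mem_filter, Finset.mem_univ, true_and]
    exact ⟨fun hv => hp v hv.1 hv.2, fun hv => ⟨hW.le_polarPerp hv, hW v hv⟩⟩
  set r : ℝ := (q : ℝ) ^ (finrank k W + 1) with hr
  have hq1 : 1 < q := Fintype.one_lt_card
  have hr0 : 0 < r := by positivity
  -- each of the sums with `t ≠ 0` is the Gauss sum of `t Q`
  have hnorm : ∀ t, t ≠ 0 → -r ≤ (P t).re := by
    intro t ht
    have hperp : polarPerp (t • Q) W = polarPerp Q W := by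
      ext v
      simp [mem_polarPerp, QuadraticMap.polar_smul, ht]
    have hts : IsTotallySingular (t • Q) W := fun v hv => by simp [hW v hv]
    have hnd : FormNondegenerate (QuadraticMap.polar (t • Q)) := fun u hu =>
      h u fun v => by simpa [QuadraticMap.polar_smul, ht] using hu v
    have hPt : quadGaussSum ψ (t • Q) = P t := by
      rw [hts.quadGaussSum_eq hψ, hperp]
      rfl
    have hn := normSq_quadGaussSum hnd hψ
    rw [hPt, hcV, Complex.normSq_apply] at hn
    have hn' : (P t).re * (P t).re ≤ r * r := by
      have : ((q ^ (2 * finrank k W + 2) : ℕ) : ℝ) = r * r := by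
        rw [hr]
        push_cast
        ring
      rw [← this, ← hn]
      nlinarith [mul_self_nonneg (P t).im]
    exact (abs_le.1 (abs_le_of_sq_le_sq (by nlinarith) hr0.le)).1
  have htotal : ∑ t, P t = (q : ℂ) * q ^ finrank k W := by
    simp only [P]
    rw [Finset.sum_comm]
    have : ∀ v ∈ S, ∑ t, ψ (t * Q v) = if Q v = 0 then (q : ℂ) else 0 := by
      intro v _
      have := sum_addChar_linearMap hψ (LinearMap.mulRight k (Q v))
      simp only [LinearMap.mulRight_apply, ← hq] at this
      have h0 : LinearMap.mulRight k (Q v) = 0 ↔ Q v = 0 :=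
        ⟨fun h0 => by simpa using LinearMap.congr_fun h0 1, fun h0 => by simp [h0]⟩
      rw [this]
      simp only [h0]
    rw [Finset.sum_congr rfl this, ← Finset.sum_filter, Finset.sum_const, hSW]
    push_cast [nsmul_eq_mul]
    ring
  have hP0 : P 0 = (q : ℂ) ^ (finrank k W + 2) := by
    simp [P, hcS]
  have hP1 : P 1 = quadGaussSum ψ Q := by
    rw [hW.quadGaussSum_eq hψ]
    simp [P, hS]
  have hsum : (∑ t, P t).re = r := by
    rw [htotal, hr]
    norm_cast
    ring
  have hP0' : (P 0).re = q * r := by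
    rw [hP0, hr]
    norm_cast
    ring
  have hsplit : ∑ t, P t = P 0 + (P 1 + ∑ t ∈ (Finset.univ.erase (0 : k)).erase 1, P t) := by
    rw [Finset.add_sum_erase _ P (by simp), Finset.add_sum_erase _ P (by simp)]
  have hrest : -((q : ℝ) - 2) * r ≤ (∑ t ∈ (Finset.univ.erase (0 : k)).erase 1, P t).re := by
    rw [Complex.re_sum]
    have hc : ((Finset.univ.erase (0 : k)).erase 1).card = q - 2 := by
      rw [Finset.card_erase_of_mem (by simp), Finset.card_erase_of_mem (by simp),
        Finset.card_univ, ← hq]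
      omega
    have := Finset.card_nsmul_le_sum ((Finset.univ.erase (0 : k)).erase 1) (fun t => (P t).re) (-r)
      fun t ht => hnorm t (by simpa using (Finset.mem_erase.1 (Finset.mem_erase.1 ht).2).1)
    rw [hc, nsmul_eq_mul, Nat.cast_sub (by omega)] at this
    push_cast at this
    linarith
  have hre := congrArg Complex.re hsplit
  rw [Complex.add_re, Complex.add_re, hsum, hP0', hP1] at hre
  nlinarith

theorem IsOMinus.quadGaussSum_re_neg [Finite k] {n : ℕ} (h : IsOMinus Q n) (hψ : ψ ≠ 1) :
    (quadGaussSum ψ Q).re < 0 := by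
  have : FiniteDimensional k V := .of_finite
  obtain ⟨W, hW, hd, hp⟩ := h.exists_totallySingular
  exact hW.quadGaussSum_re_neg h.polar_nondegenerate hd hp hψ

/-- The subspace `W` of the hypothesis need not be known to be maximal. -/
theorem IsTotallySingular.isOMinus [Finite k] (hW : IsTotallySingular Q W)
    (h : FormNondegenerate (QuadraticMap.polar Q)) (hd : finrank k V = 2 * finrank k W + 2)
    (hp : ∀ v ∈ polarPerp Q W, Q v = 0 → v ∈ W) : IsOMinus Q (finrank k V) := by
  have : FiniteDimensional k V := .of_finite
  obtain ⟨ψ, hψ⟩ := exists_addChar_ne_one k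
  refine (isOPlus_or_isOMinus_of_even (radical_eq_bot_of_polar_nondegenerate h)
    ⟨finrank k W + 1, by omega⟩).resolve_left fun hplus => ?_
  exact lt_asymm (hplus.quadGaussSum_re_pos hψ) (hW.quadGaussSum_re_neg h hd hp hψ)

end GaussSum

/-! ### Transfer along a linear functional of the field extension -/

section Transfer

variable {F K V : Type*} [Field F] [Field K] [Algebra F K] [AddCommGroup V] [Module K V]
  [Module F V] [IsScalarTower F K V] {L : K →ₗ[F] F} {Q : QuadraticForm K V}

theorem eq_zero_of_forall_map_mul_eq_zero (hL : L ≠ 0) {z : K} (h : ∀ c, L (c * z) = 0) :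
    z = 0 := by
  by_contra hz
  exact hL (LinearMap.ext fun x => by simpa [div_mul_cancel₀ x hz] using h (x / z))

theorem polar_nondegenerate_compQuadraticMap' (hL : L ≠ 0)
    (h : FormNondegenerate (QuadraticMap.polar Q)) :
    FormNondegenerate (QuadraticMap.polar (L.compQuadraticMap' Q)) := by
  intro u hu
  refine h u fun v => eq_zero_of_forall_map_mul_eq_zero hL fun c => ?_
  have := hu (c • v)
  rwa [LinearMap.compQuadraticMap_polar, QuadraticMap.polar_smul_right, smul_eq_mul] at this

variable [FiniteDimensional K V] [Finite K]

theorem IsOPlus.compQuadraticMap' (hL : L ≠ 0) {n : ℕ} (h : IsOPlus Q n) :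
    IsOPlus (L.compQuadraticMap' Q) (n * finrank F K) := by
  have : FiniteDimensional F V := Module.Finite.trans K V
  obtain ⟨W, hW, hd, -⟩ := h.exists_totallySingular
  have hn : n * finrank F K = finrank F V := by
    rw [← h.2.1, mul_comm, finrank_mul_finrank]
  rw [hn]
  refine isOPlus_of_isTotallySingular (W := W.restrictScalars F)
    (radical_eq_bot_of_polar_nondegenerate
      (polar_nondegenerate_compQuadraticMap' hL h.polar_nondegenerate))
    (fun v hv => by simp [hW v hv]) ?_
  have : finrank F (W.restrictScalars F) = finrank F K * finrank K W :=
    (finrank_mul_finrank F K W).symm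
  rw [this, ← finrank_mul_finrank F K V, hd]
  ring

/-- The Gauss sum of `L ∘ Q` is a Gauss sum of `Q`, hence negative. -/
theorem IsOMinus.compQuadraticMap' [Finite F] (hL : L ≠ 0) {n : ℕ} (h : IsOMinus Q n) :
    IsOMinus (L.compQuadraticMap' Q) (n * finrank F K) := by
  have : FiniteDimensional F V := Module.Finite.trans K V
  have : Finite V := Module.finite_of_finite K
  have := Fintype.ofFinite V
  have hn : n * finrank F K = finrank F V := by
    rw [← h.2.1, mul_comm, finrank_mul_finrank]
  have heven : Even (finrank F V) := by
    rw [← hn, h.2.2]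
    exact Even.mul_right ⟨wittIndex Q + 1, by ring⟩ _
  rw [hn]
  refine (isOPlus_or_isOMinus_of_even (radical_eq_bot_of_polar_nondegenerate
    (polar_nondegenerate_compQuadraticMap' hL h.polar_nondegenerate)) heven).resolve_left
    fun hplus => ?_
  obtain ⟨ψ, hψ⟩ := exists_addChar_ne_one F
  have hψL : ψ.compAddMonoidHom L.toAddMonoidHom ≠ 1 := by
    obtain ⟨x, hx⟩ := AddChar.ne_one_iff.1 hψ
    obtain ⟨y, rfl⟩ := LinearMap.surjective hL x
    exact AddChar.ne_one_iff.2 ⟨y, hx⟩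
  exact lt_asymm (hplus.quadGaussSum_re_pos hψ) (h.quadGaussSum_re_neg hψL)

end Transfer

/-! ### Germs -/

section Germ

variable {k V : Type*} [Field k] [AddCommGroup V] [Module k V] {Q : QuadraticForm k V}

theorem polar_sum_smul_left {ι : Type*} (s : Finset ι) (a : ι → k) (x : ι → V) (v : V) :
    QuadraticMap.polar Q (∑ i ∈ s, a i • x i) v = ∑ i ∈ s, a i * QuadraticMap.polar Q (x i) v := by
  change Q.polarBilin _ v = _
  simp

/-- The hyperbolic pairs spanning an orthogonal sum of hyperbolic lines are linearly
independent. -/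
theorem linearIndependent_hyperbolicPairs {m : ℕ} {e f : Fin m → V}
    (h : ∀ i j, QuadraticMap.polar Q (e i) (e j) = 0 ∧ QuadraticMap.polar Q (f i) (f j) = 0 ∧
      QuadraticMap.polar Q (e i) (f j) = if i = j then 1 else 0) :
    LinearIndependent k (Sum.elim e f) := by
  refine Fintype.linearIndependent_iff.2 fun c hc => ?_
  rw [Fintype.sum_sum_type] at hc
  simp only [Sum.elim_inl, Sum.elim_inr] at hc
  rintro (j | j)
  · have h1 : QuadraticMap.polar Q (∑ i, c (.inl i) • e i + ∑ i, c (.inr i) • f i) (f j) = 0 := by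
      rw [hc, QuadraticMap.polar_zero_left]
    rw [QuadraticMap.polar_add_left, polar_sum_smul_left, polar_sum_smul_left] at h1
    simpa [h] using h1
  · have h1 : QuadraticMap.polar Q (∑ i, c (.inl i) • e i + ∑ i, c (.inr i) • f i) (e j) = 0 := by
      rw [hc, QuadraticMap.polar_zero_left]
    rw [QuadraticMap.polar_add_left, polar_sum_smul_left, polar_sum_smul_left] at h1
    simp only [fun i => QuadraticMap.polar_comm Q (f i) (e j)] at h1
    simpa [h] using h1

theorem isTotallySingular_span_range {ι : Type*} {e : ι → V} (h0 : ∀ i, Q (e i) = 0)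
    (h : ∀ i j, QuadraticMap.polar Q (e i) (e j) = 0) :
    IsTotallySingular Q (Submodule.span k (Set.range e)) := by
  have key : ∀ v ∈ Submodule.span k (Set.range e),
      Q v = 0 ∧ ∀ j, QuadraticMap.polar Q v (e j) = 0 := by
    intro v hv
    induction hv using Submodule.span_induction with
    | mem x hx =>
      obtain ⟨i, rfl⟩ := hx
      exact ⟨h0 i, h i⟩
    | zero => simp
    | add x y hx hy hx' hy' =>
      refine ⟨?_, fun j => by rw [QuadraticMap.polar_add_left, hx'.2, hy'.2, add_zero]⟩
      have hxy : QuadraticMap.polar Q x y = 0 := by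
        clear hy'
        induction hy using Submodule.span_induction with
        | mem z hz =>
          obtain ⟨j, rfl⟩ := hz
          exact hx'.2 j
        | zero => simp
        | add z w _ _ hz hw => rw [QuadraticMap.polar_add_right, hz, hw, add_zero]
        | smul c z _ hz => rw [QuadraticMap.polar_smul_right, hz, smul_zero]
      rw [map_add_eq_of_polar_eq_zero hxy, hx'.1, hy'.1, add_zero]
    | smul c x _ hx =>
      exact ⟨by rw [QuadraticMap.map_smul, hx.1, smul_zero],
        fun j => by rw [QuadraticMap.polar_smul_left, hx.2, smul_zero]⟩
  exact fun v hv => (key v hv).1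

theorem hasCoefficientOn_iff {U : Submodule k V} {γ : k} :
    HasCoefficientOn Q U γ ↔ ∃ u, u ≠ 0 ∧ U = Submodule.span k {u} ∧ Q u = γ := by
  constructor
  · rintro ⟨e, he⟩
    refine ⟨e 1, fun h => ?_, le_antisymm (fun v hv => ?_) ?_, by simpa using he 1⟩
    · exact one_ne_zero (e.injective (by rw [map_zero]; exact Subtype.ext h))
    · refine Submodule.mem_span_singleton.2 ⟨e.symm ⟨v, hv⟩, ?_⟩
      rw [← Submodule.coe_smul, ← map_smul, smul_eq_mul, mul_one, LinearEquiv.apply_symm_apply]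
    · exact (Submodule.span_singleton_le_iff_mem _ _).2 (e 1).2
  · rintro ⟨u, hu, rfl, rfl⟩
    refine ⟨LinearEquiv.toSpanNonzeroSingleton k V u hu, fun x => ?_⟩
    rw [LinearEquiv.toSpanNonzeroSingleton_apply, QuadraticMap.map_smul, smul_eq_mul, mul_comm, sq]

variable [FiniteDimensional k V]

/-- The polar form identifies `V / W^⊥` with the dual of a totally singular subspace `W`. -/
theorem IsTotallySingular.exists_dual_family {W : Submodule k V} (hW : IsTotallySingular Q W)
    (h : Q.radical = ⊥) {ι : Type*} [DecidableEq ι] (b : Basis ι k W) :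
    ∃ f : ι → V, ∀ i j, QuadraticMap.polar Q (b i) (f j) = if i = j then 1 else 0 := by
  let φ : V →ₗ[k] Dual k W := (LinearMap.lcomp k k W.subtype) ∘ₗ Q.polarBilin.flip
  have hφ : ∀ v (w : W), φ v w = QuadraticMap.polar Q w v := fun _ _ => rfl
  have hker : LinearMap.ker φ = polarPerp Q W := by
    ext v
    rw [LinearMap.mem_ker, mem_polarPerp, LinearMap.ext_iff]
    simp [hφ]
  have hsurj : Function.Surjective φ := by
    rw [← LinearMap.range_eq_top]
    refine Submodule.eq_top_of_finrank_eq ?_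
    have h1 := φ.finrank_range_add_finrank_ker
    have h2 := hW.finrank_polarPerp h
    rw [hker] at h1
    rw [Subspace.dual_finrank_eq]
    omega
  choose f hf using fun j => hsurj (b.coord j)
  refine ⟨f, fun i j => ?_⟩
  rw [← hφ, hf, Basis.coord_apply, Basis.repr_self, Finsupp.single_apply]

/-- Every basis `e` of a totally singular subspace extends to a family of hyperbolic pairs: a
dual family `f` is corrected by vectors of the subspace. -/
theorem IsTotallySingular.exists_hyperbolicPairs {W : Submodule k V} (hW : IsTotallySingular Q W)
    (h : Q.radical = ⊥) {m : ℕ} (b : Basis (Fin m) k W) :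
    ∃ f : Fin m → V, (∀ i, Q (f i) = 0) ∧ ∀ i j, QuadraticMap.polar Q (f i) (f j) = 0 ∧
      QuadraticMap.polar Q (b i) (f j) = if i = j then 1 else 0 := by
  obtain ⟨g, hg⟩ := hW.exists_dual_family h b
  -- `c` is upper triangular with `c i j + c j i = polar (g i) (g j)` and `c i i = Q (g i)`
  let c : Fin m → Fin m → k := fun i j =>
    if i < j then QuadraticMap.polar Q (g i) (g j) else if i = j then Q (g i) else 0
  have hgb : ∀ i j, QuadraticMap.polar Q (g i) (b j) = if j = i then 1 else 0 := fun i j => by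
    rw [QuadraticMap.polar_comm, hg]
  have hbb : ∀ i j, QuadraticMap.polar Q (b i : V) (b j) = 0 := fun i j =>
    hW.polar_eq_zero (b i).2 (b j).2
  let s : Fin m → V := fun j => ∑ i, (-c i j) • (b i : V)
  have hs : ∀ j, s j ∈ W := fun j =>
    Submodule.sum_mem _ fun i _ => W.smul_mem _ (b i).2
  have hsg : ∀ i j, QuadraticMap.polar Q (s i) (g j) = -c j i := fun i j => by
    simp [s, polar_sum_smul_left, hg]
  have hself : ∀ i j, i ≠ j → QuadraticMap.polar Q (g i + s i) (g j + s j) = 0 := by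
    intro i j hij
    rw [QuadraticMap.polar_add_left, QuadraticMap.polar_add_right, QuadraticMap.polar_add_right,
      hsg, QuadraticMap.polar_comm Q (g i) (s j), hsg, hW.polar_eq_zero (hs i) (hs j)]
    rcases lt_or_gt_of_ne hij with hlt | hlt
    · simp [c, hlt, hlt.not_gt, hij.symm]
    · simp [c, hlt, hlt.not_gt, hij, QuadraticMap.polar_comm Q (g i) (g j)]
  have hQ : ∀ i, Q (g i + s i) = 0 := by
    intro i
    rw [QuadraticMap.map_add Q, QuadraticMap.polar_comm, hsg, hW _ (hs i)]
    simp [c]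
  refine ⟨fun j => g j + s j, hQ, fun i j => ⟨?_, ?_⟩⟩
  · by_cases hij : i = j
    · subst hij
      rw [polar_self_eq_two_mul, hQ, mul_zero]
    · exact hself i j hij
  · rw [QuadraticMap.polar_add_right, hg, hW.polar_eq_zero (b i).2 (hs j), add_zero]

theorem exists_isGerm (h : Q.radical = ⊥) : ∃ U : Submodule k V, IsGerm Q U := by
  obtain ⟨W, hW, hd⟩ := exists_finrank_eq_wittIndex Q
  let b := finBasis k W
  obtain ⟨f, hf0, hf⟩ := hW.exists_hyperbolicPairs h b
  let e : Fin (finrank k W) → V := fun i => b i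
  have hee : ∀ i j, QuadraticMap.polar Q (e i) (e j) = 0 := fun i j =>
    hW.polar_eq_zero (b i).2 (b j).2
  have hef : ∀ i j, QuadraticMap.polar Q (e i) (f j) = if i = j then 1 else 0 := fun i j =>
    (hf i j).2
  have hfe : ∀ i j, QuadraticMap.polar Q (f i) (e j) = if j = i then 1 else 0 := fun i j => by
    rw [QuadraticMap.polar_comm, hef]
  have hff : ∀ i j, QuadraticMap.polar Q (f i) (f j) = 0 := fun i j => (hf i j).1
  set R := Submodule.span k (Set.range e ∪ Set.range f) with hR
  have heR : ∀ i, e i ∈ R := fun i => Submodule.subset_span (Or.inl ⟨i, rfl⟩)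
  have hfR : ∀ i, f i ∈ R := fun i => Submodule.subset_span (Or.inr ⟨i, rfl⟩)
  have hWR : W ≤ R := by
    intro w hw
    have hsum : ((∑ i, b.repr ⟨w, hw⟩ i • b i : W) : V) = w := by rw [b.sum_repr]
    rw [← hsum, Submodule.coe_sum]
    exact Submodule.sum_mem _ fun i _ => R.smul_mem _ (heR i)
  -- the projection to `R` along `R^⊥`
  let p : V → V := fun v =>
    ∑ i, QuadraticMap.polar Q v (f i) • e i + ∑ i, QuadraticMap.polar Q v (e i) • f i
  have hpR : ∀ v, p v ∈ R := fun v => R.add_mem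
    (Submodule.sum_mem _ fun i _ => R.smul_mem _ (heR i))
    (Submodule.sum_mem _ fun i _ => R.smul_mem _ (hfR i))
  have hmem : ∀ v, v - p v ∈ polarPerp Q R := by
    intro v
    refine mem_polarPerp.2 fun w hw => ?_
    rw [QuadraticMap.polar_comm]
    induction hw using Submodule.span_induction with
    | mem x hx =>
      rcases hx with ⟨j, rfl⟩ | ⟨j, rfl⟩
      · simp [p, QuadraticMap.polar_sub_left, QuadraticMap.polar_add_left, polar_sum_smul_left,
          hee, hfe]
      · simp [p, QuadraticMap.polar_sub_left, QuadraticMap.polar_add_left, polar_sum_smul_left,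
          hff, hef]
    | zero => simp
    | add x y _ _ hx hy => rw [QuadraticMap.polar_add_right, hx, hy, add_zero]
    | smul a x _ hx => rw [QuadraticMap.polar_smul_right, hx, smul_zero]
  have hpid : ∀ v ∈ R, p v = v := by
    have hadd : ∀ x y, p (x + y) = p x + p y := by
      intro x y
      simp only [p, QuadraticMap.polar_add_left, add_smul, Finset.sum_add_distrib]
      abel
    have hsmul : ∀ (a : k) x, p (a • x) = a • p x := by
      intro a x
      simp only [p, QuadraticMap.polar_smul_left, smul_add, Finset.smul_sum, smul_assoc]
    intro v hv
    induction hv using Submodule.span_induction with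
    | mem x hx =>
      rcases hx with ⟨j, rfl⟩ | ⟨j, rfl⟩
      · simp [p, hee, hef]
      · simp [p, hff, hfe]
    | zero => simp [p]
    | add x y _ _ hx hy => rw [hadd, hx, hy]
    | smul a x _ hx => rw [hsmul, hx]
  have hdisj : ∀ v ∈ R, v ∈ polarPerp Q R → v = 0 := by
    intro v hv hv'
    have h1 : ∀ i, QuadraticMap.polar Q v (e i) = 0 := fun i => by
      rw [QuadraticMap.polar_comm, mem_polarPerp.1 hv' _ (heR i)]
    have h2 : ∀ i, QuadraticMap.polar Q v (f i) = 0 := fun i => by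
      rw [QuadraticMap.polar_comm, mem_polarPerp.1 hv' _ (hfR i)]
    rw [← hpid v hv]
    simp [p, h1, h2]
  refine ⟨polarPerp Q R, fun u hu h0 => ?_, R, ⟨?_, ?_⟩, fun r hr u hu => hu r hr,
    finrank k W, e, f, rfl, fun i => ⟨hW _ (b i).2, hf0 i⟩, fun i j => ⟨hee i j, hff i j, hef i j⟩⟩
  · have huW : u ∈ W := hW.mem_of_finrank_eq_wittIndex hd
      (mem_polarPerp.2 fun w hw => mem_polarPerp.1 hu w (hWR hw)) h0
    exact hdisj u (hWR huW) hu
  · exact Submodule.disjoint_def.2 hdisj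
  · rw [codisjoint_iff, eq_top_iff]
    intro v _
    rw [show v = p v + (v - p v) by abel]
    exact Submodule.add_mem_sup (hpR v) (hmem v)

theorem IsGerm.exists_finrank_eq {U : Submodule k V} (hU : IsGerm Q U) :
    ∃ W : Submodule k V, IsTotallySingular Q W ∧ finrank k V = 2 * finrank k W + finrank k U ∧
      (∀ w ∈ W, ∀ u ∈ U, QuadraticMap.polar Q w u = 0) ∧ W ⊓ U = ⊥ := by
  obtain ⟨-, R, hRU, hperp, m, e, f, rfl, h0, hp⟩ := hU
  have hli := linearIndependent_hyperbolicPairs hp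
  have hle : Submodule.span k (Set.range e) ≤ Submodule.span k (Set.range e ∪ Set.range f) :=
    Submodule.span_mono Set.subset_union_left
  refine ⟨Submodule.span k (Set.range e),
    isTotallySingular_span_range (fun i => (h0 i).1) fun i j => (hp i j).1, ?_,
    fun w hw u hu => hperp w (hle hw) u hu, ?_⟩
  · have h1 := Submodule.finrank_add_eq_of_isCompl hRU
    have h2 : finrank k (Submodule.span k (Set.range e ∪ Set.range f)) = m + m := by
      rw [← Set.Sum.elim_range, finrank_span_eq_card hli]
      simp
    have hle' : LinearIndependent k e := hli.comp Sum.inl Sum.inl_injective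
    have h3 := finrank_span_eq_card hle'
    rw [Fintype.card_fin] at h3
    omega
  · exact eq_bot_iff.2 ((inf_le_inf_right U hle).trans hRU.inf_eq_bot.le)

/-- A germ of a form of type `O` is a line: it is at most a plane since it is anisotropic, and
its dimension is odd. -/
theorem IsOOdd.finrank_germ [Finite k] {n : ℕ} (h : IsOOdd Q n) {U : Submodule k V}
    (hU : IsGerm Q U) : finrank k U = 1 := by
  obtain ⟨W, -, hd, -⟩ := hU.exists_finrank_eq
  have h1 := finrank_le_two_of_anisotropic hU.1
  have h2 := h.2.1
  have h3 := h.2.2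
  omega

theorem IsOOdd.exists_hasCoefficientOn [Finite k] {n : ℕ} (h : IsOOdd Q n) {U : Submodule k V}
    (hU : IsGerm Q U) : ∃ γ, γ ≠ 0 ∧ HasCoefficientOn Q U γ := by
  obtain ⟨u, hu, hspan⟩ := finrank_eq_one_iff'.1 (h.finrank_germ hU)
  have hu0 : (u : V) ≠ 0 := fun h0 => hu (Subtype.ext h0)
  refine ⟨Q u, fun h0 => hu0 (hU.1 u u.2 h0), hasCoefficientOn_iff.2 ⟨u, hu0, ?_, rfl⟩⟩
  refine le_antisymm (fun v hv => ?_) ((Submodule.span_singleton_le_iff_mem _ _).2 u.2)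
  obtain ⟨c, hc⟩ := hspan ⟨v, hv⟩
  exact Submodule.mem_span_singleton.2 ⟨c, congrArg Subtype.val hc⟩

theorem IsOOdd.exists_totallySingular_germ [Finite k] {n : ℕ} (h : IsOOdd Q n) {U : Submodule k V}
    (hU : IsGerm Q U) :
    ∃ W : Submodule k V, IsTotallySingular Q W ∧ finrank k V = 2 * finrank k W + 1 ∧
      W ⊓ U = ⊥ ∧ polarPerp Q W = W ⊔ U := by
  obtain ⟨W, hW, hd, hp, hi⟩ := hU.exists_finrank_eq
  rw [h.finrank_germ hU] at hd
  refine ⟨W, hW, hd, hi, (Submodule.eq_of_le_of_finrank_le (sup_le hW.le_polarPerp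
    fun u hu => mem_polarPerp.2 fun w hw => hp w hw u hu) ?_).symm⟩
  have h1 := hW.finrank_polarPerp h.1
  have h2 := Submodule.finrank_sup_add_finrank_inf_eq W U
  rw [hi, finrank_bot, h.finrank_germ hU] at h2
  omega

end Germ

/-! ### Transfer of forms of type `O` -/

section TransferOdd

variable {F K V : Type*} [Field F] [Field K] [Algebra F K] [AddCommGroup V] [Module K V]
  [Module F V] [IsScalarTower F K V] {L : K →ₗ[F] F} {Q : QuadraticForm K V}

theorem polarPerp_compQuadraticMap' (hL : L ≠ 0) (W : Submodule K V) :
    polarPerp (L.compQuadraticMap' Q) (W.restrictScalars F) =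
      (polarPerp Q W).restrictScalars F := by
  ext v
  simp only [mem_polarPerp, Submodule.restrictScalars_mem, LinearMap.compQuadraticMap_polar]
  refine ⟨fun h w hw => eq_zero_of_forall_map_mul_eq_zero hL fun c => ?_, fun h w hw => ?_⟩
  · simpa [QuadraticMap.polar_smul_left] using h (c • w) (W.smul_mem c hw)
  · rw [h w hw, map_zero]

variable [FiniteDimensional K V] [Finite K]

theorem finrank_restrictScalars_submodule (W : Submodule K V) :
    finrank F (W.restrictScalars F) = finrank F K * finrank K W :=
  (finrank_mul_finrank F K W).symm

theorem IsOOdd.compQuadraticMap' [Finite F] (hL : L ≠ 0) {n : ℕ} (h2 : (2 : K) ≠ 0) (h : IsOOdd Q n)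
    (hw : Odd (finrank F K)) : IsOOdd (L.compQuadraticMap' Q) (n * finrank F K) := by
  have : FiniteDimensional F V := Module.Finite.trans K V
  have hn : n * finrank F K = finrank F V := by
    rw [← h.2.1, mul_comm, finrank_mul_finrank]
  have hodd : Odd n := ⟨wittIndex Q, h.2.2⟩
  rw [hn]
  exact isOOdd_of_odd (radical_eq_bot_of_polar_nondegenerate
    (polar_nondegenerate_compQuadraticMap' hL (polar_nondegenerate_of_two_ne_zero h2 h.1)))
    (hn ▸ hodd.mul hw)

/-- In characteristic 2 the polar form has the germ `⟨u⟩` as its radical, and the additive map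
`x ↦ L (Q (x u))` from `K` to the smaller field `F` is not injective. -/
theorem IsOOdd.isDegenerateQuad_compQuadraticMap' [Finite F] (L : K →ₗ[F] F) {n : ℕ}
    (h2 : (2 : K) = 0)
    (h : IsOOdd Q n) (hw : 1 < finrank F K) : IsDegenerateQuad (L.compQuadraticMap' Q) := by
  obtain ⟨U, hU⟩ := exists_isGerm h.1
  obtain ⟨γ, -, hγ⟩ := h.exists_hasCoefficientOn hU
  obtain ⟨u, hu0, rfl, rfl⟩ := hasCoefficientOn_iff.1 hγ
  have huV : ∀ v, QuadraticMap.polar Q u v = 0 := by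
    intro v
    obtain ⟨-, R, hRU, hperp, -⟩ := hU
    obtain ⟨r, hr, x, hx, rfl⟩ :=
      Submodule.mem_sup.1 (hRU.sup_eq_top.symm ▸ Submodule.mem_top : v ∈ R ⊔ Submodule.span K {u})
    obtain ⟨c, rfl⟩ := Submodule.mem_span_singleton.1 hx
    rw [QuadraticMap.polar_add_right, QuadraticMap.polar_comm,
      hperp r hr u (Submodule.mem_span_singleton_self u), QuadraticMap.polar_smul_right,
      polar_self_eq_two_mul, h2, zero_mul, smul_zero, add_zero]
  have := Fintype.ofFinite F
  have := Fintype.ofFinite K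
  have hcard : Fintype.card F < Fintype.card K := by
    rw [card_eq_pow_finrank (K := F) (V := K)]
    exact lt_self_pow₀ Fintype.one_lt_card hw
  obtain ⟨x, y, hxy, hL⟩ := Fintype.exists_ne_map_eq_of_card_lt (fun x : K => L (Q (x • u))) hcard
  refine (Submodule.ne_bot_iff _).2 ⟨(x - y) • u, mem_radical_iff_polar.2 ⟨?_, fun v => ?_⟩,
    smul_ne_zero (sub_ne_zero.2 hxy) hu0⟩
  · have : Q ((x - y) • u) = Q (x • u) - Q (y • u) := by
      simp only [QuadraticMap.map_smul, smul_eq_mul]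
      linear_combination (y * y * Q u - x * y * Q u) * h2
    rw [LinearMap.compQuadraticMap'_apply, this, map_sub]
    exact sub_eq_zero.2 hL
  · rw [LinearMap.compQuadraticMap_polar, QuadraticMap.polar_smul_left, huV, smul_zero, map_zero]

/-- A form of type `O` becomes, over a subfield of index 2, of type `O⁺` if the form
`x ↦ L (γ x²)` on its germ is isotropic. -/
theorem IsOOdd.isOPlus_compQuadraticMap' (hL : L ≠ 0) {n : ℕ} (h2 : (2 : K) ≠ 0) (h : IsOOdd Q n)
    (hw : finrank F K = 2) {U : Submodule K V} (hU : IsGerm Q U) {γ : K}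
    (hγ : HasCoefficientOn Q U γ) (hx : ∃ x, x ≠ 0 ∧ L (γ * x ^ 2) = 0) :
    IsOPlus (L.compQuadraticMap' Q) (n * 2) := by
  have : FiniteDimensional F V := Module.Finite.trans K V
  obtain ⟨W, hW, hd, hi, hp⟩ := h.exists_totallySingular_germ hU
  obtain ⟨u, hu0, rfl, rfl⟩ := hasCoefficientOn_iff.1 hγ
  obtain ⟨x, hx0, hx⟩ := hx
  have hn : n * 2 = finrank F V := by
    rw [← h.2.1, ← hw, mul_comm, finrank_mul_finrank]
  have hmem : x • u ∈ Submodule.span K {u} :=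
    Submodule.smul_mem _ _ (Submodule.mem_span_singleton_self u)
  have hWT : IsTotallySingular (L.compQuadraticMap' Q) (W.restrictScalars F) := fun v hv => by
    simp [hW v hv]
  have h0 : L.compQuadraticMap' Q (x • u) = 0 := by
    rw [LinearMap.compQuadraticMap'_apply, QuadraticMap.map_smul, smul_eq_mul, ← hx]
    ring_nf
  have hsup := hWT.sup (isTotallySingular_span_singleton h0) (by
    rw [Submodule.span_singleton_le_iff_mem, polarPerp_compQuadraticMap' hL, hp]
    exact Submodule.mem_sup_right hmem)
  rw [hn]
  refine isOPlus_of_isTotallySingular (radical_eq_bot_of_polar_nondegenerate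
    (polar_nondegenerate_compQuadraticMap' hL (polar_nondegenerate_of_two_ne_zero h2 h.1))) hsup ?_
  have hinf : W.restrictScalars F ⊓ Submodule.span F {x • u} = ⊥ := by
    rw [eq_bot_iff]
    rintro v ⟨hv, hv'⟩
    obtain ⟨c, rfl⟩ := Submodule.mem_span_singleton.1 hv'
    have : c • x • u ∈ W ⊓ Submodule.span K {u} := ⟨hv, by
      rw [← algebraMap_smul K]
      exact Submodule.smul_mem _ _ hmem⟩
    rwa [hi] at this
  have h3 := Submodule.finrank_sup_add_finrank_inf_eq (W.restrictScalars F)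
    (Submodule.span F {x • u})
  rw [hinf, finrank_bot, finrank_span_singleton (smul_ne_zero hx0 hu0),
    finrank_restrictScalars_submodule, hw] at h3
  have h4 := finrank_mul_finrank F K V
  rw [hw] at h4
  omega

/-- A form of type `O` becomes, over a subfield of index 2, of type `O⁻` if the form
`x ↦ L (γ x²)` on its germ is anisotropic. -/
theorem IsOOdd.isOMinus_compQuadraticMap' [Finite F] (hL : L ≠ 0) {n : ℕ} (h2 : (2 : K) ≠ 0)
    (h : IsOOdd Q n) (hw : finrank F K = 2) {U : Submodule K V} (hU : IsGerm Q U) {γ : K}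
    (hγ : HasCoefficientOn Q U γ) (hx : ¬ ∃ x, x ≠ 0 ∧ L (γ * x ^ 2) = 0) :
    IsOMinus (L.compQuadraticMap' Q) (n * 2) := by
  have : FiniteDimensional F V := Module.Finite.trans K V
  have : Finite V := Module.finite_of_finite K
  have := Fintype.ofFinite V
  obtain ⟨W, hW, hd, hi, hp⟩ := h.exists_totallySingular_germ hU
  obtain ⟨u, hu0, rfl, rfl⟩ := hasCoefficientOn_iff.1 hγ
  have h4 := finrank_mul_finrank F K V
  rw [hw] at h4
  have hn : n * 2 = finrank F V := by
    rw [← h.2.1, ← h4, mul_comm]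
  have hWT : IsTotallySingular (L.compQuadraticMap' Q) (W.restrictScalars F) := fun v hv => by
    simp [hW v hv]
  rw [hn]
  refine hWT.isOMinus (polar_nondegenerate_compQuadraticMap' hL
    (polar_nondegenerate_of_two_ne_zero h2 h.1)) ?_ fun v hv h0 => ?_
  · rw [finrank_restrictScalars_submodule, hw]
    omega
  · rw [polarPerp_compQuadraticMap' hL, Submodule.restrictScalars_mem, hp] at hv
    obtain ⟨w, hwW, y, hy, rfl⟩ := Submodule.mem_sup.1 hv
    have hpol : QuadraticMap.polar Q w y = 0 :=
      mem_polarPerp.1 (hp ▸ Submodule.mem_sup_right hy : y ∈ polarPerp Q W) w hwW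
    obtain ⟨c, rfl⟩ := Submodule.mem_span_singleton.1 hy
    rw [LinearMap.compQuadraticMap'_apply, map_add_eq_of_polar_eq_zero hpol, hW w hwW, zero_add,
      QuadraticMap.map_smul, smul_eq_mul] at h0
    have hc : c = 0 := by
      by_contra hc
      exact hx ⟨c, hc, by rw [← h0]; ring_nf⟩
    simpa [hc] using hwW

end TransferOdd

/-! ### Subfields, traces and squares in finite fields -/

section FiniteFields

theorem mem_fieldRange_iff_pow_natCard {F K : Type*} [Field F] [Finite F] [Field K]
    (f : F →+* K) {x : K} : x ∈ f.fieldRange ↔ x ^ Nat.card F = x := by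
  classical
  have := Fintype.ofFinite F
  rw [Nat.card_eq_fintype_card]
  constructor
  · rintro ⟨y, rfl⟩
    rw [← map_pow, FiniteField.pow_card]
  intro hx
  have h1 : 1 < Fintype.card F := Fintype.one_lt_card
  have hne := FiniteField.X_pow_card_sub_X_ne_zero K h1
  set p : Polynomial K := Polynomial.X ^ Fintype.card F - Polynomial.X with hp
  have hsub : Finset.univ.image f ⊆ p.roots.toFinset := by
    intro y hy
    obtain ⟨z, -, rfl⟩ := Finset.mem_image.1 hy
    rw [Multiset.mem_toFinset, Polynomial.mem_roots hne]
    simp [hp, ← map_pow, FiniteField.pow_card]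
  have hcard : p.roots.toFinset.card ≤ (Finset.univ.image f).card := by
    rw [Finset.card_image_of_injective _ f.injective, Finset.card_univ,
      ← FiniteField.X_pow_card_sub_X_natDegree_eq K h1]
    exact (Multiset.toFinset_card_le _).trans (Polynomial.card_roots' _)
  have hxp : x ∈ p.roots.toFinset := by
    rw [Multiset.mem_toFinset, Polynomial.mem_roots hne]
    simp [hp, hx]
  rw [← Finset.eq_of_subset_of_card_le hsub hcard] at hxp
  obtain ⟨y, -, rfl⟩ := Finset.mem_image.1 hxp
  exact ⟨y, rfl⟩

theorem Subfield.mem_iff_pow_natCard {K : Type*} [Field K] [Finite K] (E : Subfield K) {x : K} :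
    x ∈ E ↔ x ^ Nat.card E = x := by
  rw [← mem_fieldRange_iff_pow_natCard E.subtype, E.fieldRange_subtype]

theorem natCard_odd_iff_two_ne_zero {k : Type*} [Field k] [Finite k] :
    Odd (Nat.card k) ↔ (2 : k) ≠ 0 := by
  have := Fintype.ofFinite k
  rw [Nat.card_eq_fintype_card, ← Nat.not_even_iff_odd, Nat.even_iff,
    ← FiniteField.even_card_iff_char_two, not_iff_not]
  constructor
  · intro h
    exact_mod_cast (ringChar.spec k 2).2 h.dvd
  · intro h
    have : ringChar k ∣ 2 := (ringChar.spec k 2).1 (by exact_mod_cast h)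
    exact ((Nat.dvd_prime Nat.prime_two).1 this).resolve_left (CharP.ringChar_ne_one)

variable {E K : Type*} [Field E] [Field K] [Algebra E K] [Finite K]

theorem algebraMap_trace_of_finrank_eq_two (h : finrank E K = 2) (x : K) :
    algebraMap E K (Algebra.trace E K x) = x + x ^ Nat.card E := by
  rw [FiniteField.algebraMap_trace_eq_sum_pow, h]
  simp [Finset.sum_range_succ]

theorem natCard_eq_sq_of_finrank_eq_two (h : finrank E K = 2) : Nat.card K = Nat.card E ^ 2 := by
  rw [natCard_eq_pow_finrank (K := E) (V := K), h]

theorem add_pow_natCard (E : Type*) {K : Type*} [Field E] [Finite E] [Field K] [Algebra E K]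
    (x y : K) : (x + y) ^ Nat.card E = x ^ Nat.card E + y ^ Nat.card E := by
  have := Fintype.ofFinite E
  rw [Nat.card_eq_fintype_card]
  exact map_add (FiniteField.frobeniusAlgHom E K) x y

/-- Hilbert 90 for a quadratic extension of finite fields of odd characteristic, combined with
Euler's criterion: the form `x ↦ Tr (δ x²)` is anisotropic if and only if `-N(δ)` is a
square of the subfield, where `N(δ) = δ ^ (|E| + 1)`. -/
theorem exists_trace_mul_sq_eq_zero_iff (h : finrank E K = 2) (h2 : (2 : K) ≠ 0) {δ : K}
    (hδ : δ ≠ 0) :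
    (∃ x, x ≠ 0 ∧ Algebra.trace E K (δ * x ^ 2) = 0) ↔
      ¬ ∃ z : E, z ≠ 0 ∧ δ ^ (Nat.card E + 1) = -1 * algebraMap E K z ^ 2 := by
  have hE : Finite E := Finite.of_injective _ (algebraMap E K).injective
  have := Fintype.ofFinite E
  have := Fintype.ofFinite K
  set s := Nat.card E with hs
  have hcard : Fintype.card K = s ^ 2 := by
    rw [← Nat.card_eq_fintype_card, natCard_eq_sq_of_finrank_eq_two h]
  have hss : ∀ x : K, (x ^ s) ^ s = x := fun x => by
    rw [← pow_mul, ← sq, ← hcard, FiniteField.pow_card]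
  have hz : ∀ z : E, algebraMap E K z ^ s = algebraMap E K z := fun z => by
    rw [← map_pow, hs, Nat.card_eq_fintype_card, FiniteField.pow_card]
  have h2E : (2 : E) ≠ 0 := fun h0 => h2 (by rw [← map_ofNat (algebraMap E K) 2, h0, map_zero])
  have hsodd : Odd s := natCard_odd_iff_two_ne_zero.2 h2E
  have htr : ∀ y : K, Algebra.trace E K y = 0 ↔ y ^ s = -y := fun y => by
    rw [← (algebraMap E K).injective.eq_iff, algebraMap_trace_of_finrank_eq_two h, map_zero,
      add_comm, ← hs, add_eq_zero_iff_eq_neg]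
  constructor
  · rintro ⟨x, hx0, hx⟩ ⟨z, hz0, hδz⟩
    rw [htr, mul_pow, ← pow_mul] at hx
    have hz0' : algebraMap E K z ≠ 0 := by simpa using hz0
    have hsq : (δ * x) ^ 2 = (algebraMap E K z * x ^ s) ^ 2 := by
      have h1 : δ ^ (s + 1) * (x ^ s) ^ 2 = -(δ * x) ^ 2 := by
        calc δ ^ (s + 1) * (x ^ s) ^ 2 = δ * (δ ^ s * x ^ (2 * s)) := by ring
          _ = _ := by rw [hx]; ring
      rw [hδz] at h1
      linear_combination h1
    -- both signs of the square root lead to `N(δ) = z²`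
    have key : δ ^ (s + 1) * x ^ (s + 1) = algebraMap E K z ^ 2 * x ^ (s + 1) := by
      rcases sq_eq_sq_iff_eq_or_eq_neg.1 hsq with h1 | h1
      · have h3 : (δ * x) ^ s = algebraMap E K z * x := by rw [h1, mul_pow, hz, hss]
        calc δ ^ (s + 1) * x ^ (s + 1) = (δ * x) ^ s * (δ * x) := by ring
          _ = _ := by rw [h3, h1]; ring
      · have h3 : (δ * x) ^ s = -(algebraMap E K z * x) := by
          rw [h1, hsodd.neg_pow, mul_pow, hz, hss]
        calc δ ^ (s + 1) * x ^ (s + 1) = (δ * x) ^ s * (δ * x) := by ring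
          _ = _ := by rw [h3, h1]; ring
    have h4 := mul_right_cancel₀ (pow_ne_zero _ hx0) key
    rw [hδz] at h4
    exact mul_ne_zero h2 (pow_ne_zero 2 hz0') (by linear_combination -h4)
  · intro hne
    -- `ε` spans the elements of trace zero
    obtain ⟨y, hy⟩ : ∃ y : K, y ^ s ≠ y := by
      by_contra! hall
      have htop : Function.Surjective (algebraMap E K) := fun y =>
        (mem_fieldRange_iff_pow_natCard (algebraMap E K)).2 (hall y)
      have h1 := Nat.card_le_card_of_surjective _ htop
      rw [natCard_eq_sq_of_finrank_eq_two h, ← hs] at h1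
      have h3 : 1 < s := Finite.one_lt_card
      nlinarith
    set ε := y - y ^ s with hε
    have hε0 : ε ≠ 0 := sub_ne_zero.2 hy.symm
    have hεs : ε ^ s = -ε := by
      have h1 := add_pow_natCard E ε (y ^ s)
      rw [← hs, hss, hε, sub_add_cancel] at h1
      rw [hε]
      linear_combination -h1
    have hnorm : (-δ ^ (s + 1)) ^ s = -δ ^ (s + 1) := by
      rw [hsodd.neg_pow, pow_succ, mul_pow, hss, mul_comm]
    obtain ⟨n, hn⟩ : ∃ n : E, algebraMap E K n = -δ ^ (s + 1) :=
      (mem_fieldRange_iff_pow_natCard (algebraMap E K)).2 hnorm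
    have hn0 : n ≠ 0 := by
      rintro rfl
      rw [map_zero] at hn
      exact neg_ne_zero.2 (pow_ne_zero _ hδ) hn.symm
    have hnsq : ¬ IsSquare n := by
      rintro ⟨z, rfl⟩
      refine hne ⟨z, fun h0 => hn0 (by simp [h0]), ?_⟩
      rw [map_mul] at hn
      linear_combination hn
    have hcharE : ringChar E ≠ 2 := fun hc => h2E (by
      exact_mod_cast (ringChar.spec E 2).2 hc.dvd)
    have hcharK : ringChar K ≠ 2 := fun hc => h2 (by
      exact_mod_cast (ringChar.spec K 2).2 hc.dvd)
    obtain ⟨t, ht⟩ := hsodd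
    have hpow : algebraMap E K n ^ t = -1 := by
      have h1 := (FiniteField.pow_dichotomy hcharE hn0).resolve_left
        fun h0 => hnsq ((FiniteField.isSquare_iff hcharE hn0).2 h0)
      rw [← Nat.card_eq_fintype_card, ← hs, ht, show (2 * t + 1) / 2 = t by omega] at h1
      rw [← map_pow, h1, map_neg, map_one]
    have hε1 : (ε ^ 2) ^ t = -1 := by
      refine mul_right_cancel₀ hε0 ?_
      rw [← pow_mul, ← pow_succ, ← ht, hεs, neg_one_mul]
    have hsquare : IsSquare (δ * ε) := by
      rw [FiniteField.isSquare_iff hcharK (mul_ne_zero hδ hε0), hcard,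
        show s ^ 2 / 2 = (s + 1) * t by
          rw [ht, show (2 * t + 1) ^ 2 = 2 * ((2 * t + 1 + 1) * t) + 1 by ring]
          omega, pow_mul]
      have h1 : (δ * ε) ^ (s + 1) = algebraMap E K n * ε ^ 2 := by
        rw [mul_pow, hn, pow_succ ε, hεs]
        ring
      rw [h1, mul_pow, hpow, hε1]
      ring
    obtain ⟨r, hr⟩ := hsquare
    have hr0 : r ≠ 0 := by
      rintro rfl
      rw [mul_zero] at hr
      exact mul_ne_zero hδ hε0 hr
    refine ⟨ε / r, div_ne_zero hε0 hr0, (htr _).2 ?_⟩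
    have : δ * (ε / r) ^ 2 = ε := by
      rw [div_pow, sq r, ← hr]
      field_simp
    rw [this, hεs]

end FiniteFields

section TraceMul

variable {F K : Type*} [Field F] [Field K] [Algebra F K]

@[simp]
theorem traceMul_apply (α x : K) : traceMul F α x = Algebra.trace F K (α * x) := rfl

theorem traceMul_ne_zero [Finite K] {α : K} (hα : α ≠ 0) : traceMul F α ≠ 0 := by
  have : Finite F := Finite.of_injective _ (algebraMap F K).injective
  intro h
  refine Algebra.trace_ne_zero F K (LinearMap.ext fun x => ?_)
  have := LinearMap.congr_fun h (α⁻¹ * x)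
  rwa [traceMul_apply, mul_inv_cancel_left₀ hα] at this

theorem traceMul_injective [Finite K] {a b : K}
    (h : ∀ c, traceMul F a c = traceMul F b c) : a = b := by
  by_contra hab
  refine traceMul_ne_zero (F := F) (sub_ne_zero.2 hab) (LinearMap.ext fun c => ?_)
  have := h c
  rw [traceMul_apply, traceMul_apply] at this
  rw [traceMul_apply, sub_mul, map_sub, this, sub_self, LinearMap.zero_apply]

theorem traceMul_tower {E : Type*} [Field E] [Algebra F E] [Algebra E K] [IsScalarTower F E K]
    [Finite K] (α x : K) : traceMul F α x = Algebra.trace F E (traceMul E α x) := by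
  have : Finite E := Finite.of_injective _ (algebraMap E K).injective
  rw [traceMul_apply, traceMul_apply, Algebra.trace_trace]

end TraceMul

/-! ### The classification for quadratic forms -/

section Classification

theorem IsOPlus.not_isOMinus {k V : Type*} [Field k] [AddCommGroup V] [Module k V]
    {Q : QuadraticForm k V} {n : ℕ} (h : IsOPlus Q n) : ¬ IsOMinus Q n := by
  intro h'
  have h1 := h.2.2
  have h2 := h'.2.2
  omega

theorem isScalarTower_intermediateField {F K V : Type*} [Field F] [Field K] [Algebra F K]
    [AddCommGroup V] [Module K V] [Module F V] [IsScalarTower F K V] (E : IntermediateField F K) :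
    IsScalarTower F E V :=
  ⟨fun f e v => smul_assoc f (e : K) v⟩

theorem compQuadraticMap'_traceMul_tower {F K V : Type*} [Field F] [Field K] [Finite K]
    [Algebra F K] [AddCommGroup V] [Module K V] [Module F V] [IsScalarTower F K V]
    (E : IntermediateField F K) (α : K) (Q : QuadraticForm K V) :
    haveI := isScalarTower_intermediateField (V := V) E
    (Algebra.trace F E).compQuadraticMap' ((traceMul E α).compQuadraticMap' Q) =
      (traceMul F α).compQuadraticMap' Q := by
  ext v
  exact (traceMul_tower (F := F) (E := E) α (Q v)).symm

/-- If `δ²` is a nonsquare of the quadratic subfield `E` then `δ` has trace zero, and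
`N(δ) = -δ²`. -/
theorem InWithoutSquares.not_congrModSquares {K : Type*} [Field K] [Finite K]
    {E : Subfield K} {δ : K} (h : InWithoutSquares E (δ ^ 2)⁻¹) :
    ¬ CongrModSquares E (δ ^ (Nat.card E + 1)) (-1) := by
  rintro ⟨z, hzE, hz0, hz⟩
  obtain ⟨hE, hsq⟩ := h
  have hδ0 : δ ≠ 0 := by
    rintro rfl
    rw [zero_pow (Nat.succ_ne_zero _)] at hz
    exact hz0 (by simpa using hz)
  have hδE : δ ∉ E := fun hδ => hsq ⟨δ⁻¹, E.inv_mem hδ, inv_ne_zero hδ0, (inv_pow δ 2).symm⟩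
  have hE' : δ ^ 2 ∈ E := by simpa using E.inv_mem hE
  have h1 : (δ ^ Nat.card E) ^ 2 = δ ^ 2 := by
    rw [← pow_mul, mul_comm, pow_mul]
    exact E.mem_iff_pow_natCard.1 hE'
  rcases sq_eq_sq_iff_eq_or_eq_neg.1 h1 with h3 | h3
  · exact hδE (E.mem_iff_pow_natCard.2 h3)
  · rw [pow_succ, h3] at hz
    refine hsq ⟨z⁻¹, E.inv_mem hzE, inv_ne_zero hz0, ?_⟩
    rw [inv_pow, inv_inj]
    linear_combination -hz

variable {F K : Type*} [Field F] [Finite F] [Field K] [Finite K] [Algebra F K]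

theorem exists_subfield_natCard_eq (hw : Even (finrank F K)) :
    ∃ E : Subfield K, Nat.card E = Nat.card F ^ (finrank F K / 2) := by
  obtain ⟨p, hp⟩ := CharP.exists F
  have : Fact p.Prime := ⟨CharP.char_is_prime F p⟩
  have hpos : 0 < finrank F K := finrank_pos
  have : NeZero (finrank F K / 2) := ⟨by obtain ⟨r, hr⟩ := hw; omega⟩
  obtain ⟨f⟩ := FiniteField.nonempty_algHom_of_finrank_dvd
    (F := F) (K := FiniteField.Extension F p (finrank F K / 2)) (L := K) (by
      rw [FiniteField.finrank_extension]
      exact Nat.div_dvd_of_dvd hw.two_dvd)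
  refine ⟨f.toRingHom.fieldRange, ?_⟩
  rw [← FiniteField.natCard_extension F p]
  exact (Nat.card_congr (Equiv.ofInjective f f.injective)).symm

/-- A subfield of order `|F| ^ ([K : F] / 2)` contains `F`, and `K` has degree 2 over it. -/
theorem exists_intermediateField_of_natCard (hw : Even (finrank F K)) (E : Subfield K)
    (hE : Nat.card E = Nat.card F ^ (finrank F K / 2)) :
    ∃ E' : IntermediateField F K, E'.toSubfield = E ∧ finrank E' K = 2 ∧
      finrank F E' = finrank F K / 2 := by
  have := Fintype.ofFinite F
  have hmem : ∀ x : F, algebraMap F K x ∈ E := fun x => by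
    rw [E.mem_iff_pow_natCard, hE, ← map_pow, Nat.card_eq_fintype_card, FiniteField.pow_card_pow]
  let E' : IntermediateField F K := E.toIntermediateField hmem
  have hF : finrank F E' = finrank F K / 2 := by
    have h1 : Nat.card E' = Nat.card F ^ finrank F E' := natCard_eq_pow_finrank
    exact Nat.pow_right_injective (show 2 ≤ Nat.card F from Finite.one_lt_card) (h1.symm.trans hE)
  have hpos : 0 < finrank F K := finrank_pos
  have h3 := finrank_mul_finrank F E' K
  refine ⟨E', rfl, ?_, hF⟩
  obtain ⟨r, hr⟩ := hw
  rw [hF, hr, show (r + r) / 2 = r by omega] at h3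
  have hr0 : 0 < r := by omega
  exact Nat.eq_of_mul_eq_mul_left hr0 (by omega)

variable {V : Type*} [AddCommGroup V] [Module K V] [Module F V] [IsScalarTower F K V]

variable [FiniteDimensional K V]

/-- The last two rows of the classification: the type is decided over the subfield `E` of index
2, and transferring further down to `F` does not change it. -/
theorem IsOOdd.type_of_even {α : K} (hα : α ≠ 0) {Q : QuadraticForm K V} {n : ℕ} (h : IsOOdd Q n)
    (h2 : (2 : K) ≠ 0) (hw : Even (finrank F K)) {E : Subfield K}
    (hE : Nat.card E = Nat.card F ^ (finrank F K / 2)) {U : Submodule K V} {γ : K}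
    (hU : IsGerm Q U) (hγ : HasCoefficientOn Q U γ) :
    (¬ CongrModSquares E ((α * γ) ^ (Nat.card F ^ (finrank F K / 2) + 1)) (-1) →
      IsOPlus ((traceMul F α).compQuadraticMap' Q) (n * finrank F K)) ∧
    (CongrModSquares E ((α * γ) ^ (Nat.card F ^ (finrank F K / 2) + 1)) (-1) →
      IsOMinus ((traceMul F α).compQuadraticMap' Q) (n * finrank F K)) := by
  obtain ⟨E', rfl, hK, hF⟩ := exists_intermediateField_of_natCard hw E hE
  have := isScalarTower_intermediateField (V := V) E'
  have hγ0 : γ ≠ 0 := by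
    obtain ⟨u, hu, rfl, rfl⟩ := hasCoefficientOn_iff.1 hγ
    exact fun h0 => hu (hU.1 u (Submodule.mem_span_singleton_self u) h0)
  have hL : traceMul E' α ≠ 0 := traceMul_ne_zero hα
  have htr : Algebra.trace F E' ≠ 0 := Algebra.trace_ne_zero F E'
  have hfd : FiniteDimensional E' V := Module.Finite.trans K V
  have hn : n * finrank F K = n * 2 * finrank F E' := by
    rw [← finrank_mul_finrank F E' K, hK]
    ring
  have hcongr : CongrModSquares E'.toSubfield
      ((α * γ) ^ (Nat.card F ^ (finrank F K / 2) + 1)) (-1) ↔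
      ¬ ∃ x, x ≠ 0 ∧ traceMul E' α (γ * x ^ 2) = 0 := by
    simp only [traceMul_apply, ← mul_assoc]
    rw [exists_trace_mul_sq_eq_zero_iff hK h2 (mul_ne_zero hα hγ0), not_not, ← hE]
    constructor
    · rintro ⟨z, hzE, hz0, hz⟩
      exact ⟨⟨z, hzE⟩, fun h0 => hz0 (congrArg Subtype.val h0), hz⟩
    · rintro ⟨z, hz0, hz⟩
      exact ⟨z, z.2, fun h0 => hz0 (Subtype.ext h0), hz⟩
  rw [hcongr, not_not, ← compQuadraticMap'_traceMul_tower E', hn]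
  exact ⟨fun hx => (h.isOPlus_compQuadraticMap' hL h2 hK hU hγ hx).compQuadraticMap' htr,
    fun hx => (h.isOMinus_compQuadraticMap' hL h2 hK hU hγ hx).compQuadraticMap' htr⟩

theorem quadraticClassification {α : K} (hα : α ≠ 0) (Q : QuadraticForm K V) :
    QuadraticClassification (Nat.card F) (finrank F K) (finrank K V) α Q
      ((traceMul F α).compQuadraticMap' Q) := by
  have hL : traceMul F α ≠ 0 := traceMul_ne_zero hα
  have h2iff : (2 : F) = 0 ↔ (2 : K) = 0 := by
    rw [← map_ofNat (algebraMap F K) 2, map_eq_zero]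
  have h2odd : Odd (Nat.card F) → (2 : K) ≠ 0 := fun h h0 =>
    natCard_odd_iff_two_ne_zero.1 h (h2iff.2 h0)
  refine ⟨?_, fun h => h.compQuadraticMap' hL, fun h => h.compQuadraticMap' hL,
    fun h => exists_isGerm h.1, fun h U hU => h.exists_hasCoefficientOn hU, ?_,
    fun h hw hq => h.compQuadraticMap' hL (h2odd hq) hw, exists_subfield_natCard_eq, ?_, ?_⟩
  · rintro _ ⟨g, hg, rfl⟩ v
    exact congrArg (traceMul F α) (hg v)
  · intro h hq hw
    refine h.isDegenerateQuad_compQuadraticMap' _ ?_ hw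
    rw [← h2iff]
    by_contra h2
    exact Nat.not_even_iff_odd.2 (natCard_odd_iff_two_ne_zero.2 h2) hq
  · intro h hw hq E hE U γ hU hγ
    obtain ⟨h1, h3⟩ := h.type_of_even hα (h2odd hq) hw hE hU hγ
    constructor
    · exact fun hp => Or.inr fun hc => hp.not_isOMinus (h3 hc)
    · rintro (hs | hc)
      · exact h1 (hE ▸ hs.not_congrModSquares)
      · exact h1 hc
  · intro h hw hq E hE U γ hU hγ
    obtain ⟨h1, h3⟩ := h.type_of_even hα (h2odd hq) hw hE hU hγ
    constructor
    · intro hm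
      have hc : CongrModSquares E ((α * γ) ^ (Nat.card F ^ (finrank F K / 2) + 1)) (-1) :=
        by_contra fun hc => (h1 hc).not_isOMinus hm
      exact ⟨fun hs => hs.not_congrModSquares (hE ▸ hc), hc⟩
    · exact fun hc => h3 hc.2

end Classification

/-! ### Sesquilinear forms -/

section Sesquilinear

theorem IsSesquilinear.exists_eq {k V : Type*} [Field k] [AddCommGroup V] [Module k V]
    [Nontrivial V] {σ : k ≃+* k} {b : V → V → k} (h : IsSesquilinear σ b)
    (hb : FormNondegenerate b) (c : k) : ∃ x y, b x y = c := by
  obtain ⟨u, hu⟩ := exists_ne (0 : V)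
  obtain ⟨v, hv⟩ : ∃ v, b u v ≠ 0 := by
    by_contra! h0
    exact hu (hb u h0)
  exact ⟨(c / b u v) • u, v, by rw [h.smul_left, div_mul_cancel₀ c hv]⟩

theorem IsSesquilinear.unique {k V : Type*} [Field k] [AddCommGroup V] [Module k V]
    {σ τ : k ≃+* k} {b : V → V → k} (h : IsSesquilinear σ b) (h' : IsSesquilinear τ b)
    {x y : V} (hxy : b x y ≠ 0) : σ = τ := by
  ext c
  exact mul_right_cancel₀ hxy ((h.smul_right c x y).symm.trans (h'.smul_right c x y))

theorem IsAlternatingForm.neg {k V : Type*} [Field k] [AddCommGroup V] [Module k V]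
    {b : V → V → k} (h : IsAlternatingForm b) (x y : V) : b x y = -b y x := by
  have h1 := h.2 (x + y)
  rw [h.1.add_left, h.1.add_right, h.1.add_right, h.2, h.2, zero_add, add_zero] at h1
  exact eq_neg_of_add_eq_zero_left h1

variable {F K V : Type*} [Field F] [Field K] [Algebra F K] [AddCommGroup V] [Module K V]
  {σ : K ≃+* K} {β : V → V → K} {α : K} {τ : F ≃+* F}

theorem isomForm_map_restrictGL_le [Module F V] [IsScalarTower F K V]
    (L : K →ₗ[F] F) (β : V → V → K) :
    (isomForm β).map (restrictGL F K V) ≤ isomForm (fun x y => L (β x y)) := by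
  rintro _ ⟨g, hg, rfl⟩ u v
  exact congrArg L (hg u v)

theorem trace_ringEquiv_apply (hτ : ∀ x, algebraMap F K (τ x) = σ (algebraMap F K x))
    (x : K) : Algebra.trace F K (σ x) = τ (Algebra.trace F K x) := by
  rw [Algebra.trace_eq_of_equiv_equiv τ σ (RingHom.ext hτ) x, RingEquiv.apply_symm_apply]

theorem IsSesquilinear.traceMul_comp [Module F V] [IsScalarTower F K V]
    (hτ : ∀ x, algebraMap F K (τ x) = σ (algebraMap F K x))
    (h : IsSesquilinear σ β) (α : K) :
    IsSesquilinear τ (fun x y => traceMul F α (β x y)) := by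
  have hsm : ∀ (c : F) (v : V), c • v = algebraMap F K c • v := fun c v =>
    (algebraMap_smul K c v).symm
  refine ⟨fun x y z => by rw [h.add_left, map_add], fun c x y => ?_,
    fun x y z => by rw [h.add_right, map_add], fun c x y => ?_⟩
  · rw [hsm, h.smul_left, ← Algebra.smul_def, map_smul, smul_eq_mul]
  · rw [hsm, h.smul_right, ← hτ, ← Algebra.smul_def, map_smul, smul_eq_mul]

variable [Finite K]

theorem FormNondegenerate.traceMul_comp (h : IsSesquilinear σ β) (hb : FormNondegenerate β)
    (hα : α ≠ 0) : FormNondegenerate (fun x y => traceMul F α (β x y)) := by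
  intro u hu
  refine hb u fun v => eq_zero_of_forall_map_mul_eq_zero (traceMul_ne_zero (F := F) hα) fun c => ?_
  have : traceMul F α (β u (σ.symm c • v)) = 0 := hu _
  rwa [h.smul_right, RingEquiv.apply_symm_apply] at this

/-- An automorphism of `K` restricts to the subfield `F`, the set of solutions of
`x ^ |F| = x`. -/
theorem exists_ringEquiv_restrict (F : Type*) {K : Type*} [Field F] [Field K] [Finite K]
    [Algebra F K] (σ : K ≃+* K) :
    ∃ τ : F ≃+* F, ∀ x, algebraMap F K (τ x) = σ (algebraMap F K x) := by
  have : Finite F := Finite.of_injective _ (algebraMap F K).injective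
  have hinj := (algebraMap F K).injective
  have h : ∀ x, ∃ y, algebraMap F K y = σ (algebraMap F K x) := fun x => by
    refine (mem_fieldRange_iff_pow_natCard (algebraMap F K)).2 ?_
    rw [← map_pow, (mem_fieldRange_iff_pow_natCard (algebraMap F K)).1 ⟨x, rfl⟩]
  choose g hg using h
  let f : F →+* F :=
    { toFun := g
      map_one' := hinj (by rw [hg, map_one, map_one])
      map_mul' := fun x y => hinj (by simp only [hg, map_mul])
      map_zero' := hinj (by rw [hg, map_zero, map_zero])
      map_add' := fun x y => hinj (by simp only [hg, map_add]) }
  exact ⟨RingEquiv.ofBijective f (Finite.injective_iff_bijective.1 f.injective), hg⟩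

/-- The scalar `a` is determined by the form `(x, y) ↦ Tr (a β(x, y))`, whence the conditions
relating `σ α` to `α`. -/
theorem IsHermitianForm.traceMul_eq_iff [Nontrivial V]
    (hτ : ∀ x, algebraMap F K (τ x) = σ (algebraMap F K x))
    (h : IsHermitianForm σ β) (hb : FormNondegenerate β) (ε : F) :
    (∀ x y, traceMul F α (β x y) = ε * τ (traceMul F α (β y x))) ↔
      α = algebraMap F K ε * σ α := by
  have key : ∀ x y, ε * τ (traceMul F α (β y x)) =
      traceMul F (algebraMap F K ε * σ α) (β x y) := by
    intro x y
    rw [traceMul_apply, ← trace_ringEquiv_apply hτ, map_mul, ← h.2.2.2, traceMul_apply, mul_assoc,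
      ← Algebra.smul_def, map_smul, smul_eq_mul]
  simp only [key]
  refine ⟨fun h1 => traceMul_injective (F := F) fun c => ?_, fun h1 x y => by rw [← h1]⟩
  obtain ⟨x, y, rfl⟩ := h.1.exists_eq hb c
  exact h1 x y

theorem IsHermitianForm.traceMul_symm_iff [Nontrivial V]
    (hτ : ∀ x, algebraMap F K (τ x) = σ (algebraMap F K x))
    (h : IsHermitianForm σ β) (hb : FormNondegenerate β) :
    (∀ x y, traceMul F α (β x y) = τ (traceMul F α (β y x))) ↔ σ α = α := by
  have := h.traceMul_eq_iff (α := α) hτ hb 1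
  simp only [one_mul, map_one] at this
  rw [this, eq_comm]

theorem IsHermitianForm.exists_traceMul_ne_zero [Nontrivial V] (h : IsHermitianForm σ β)
    (hb : FormNondegenerate β) (hα : α ≠ 0) : ∃ x y, traceMul F α (β x y) ≠ 0 := by
  obtain ⟨u, hu⟩ := exists_ne (0 : V)
  by_contra! h0
  exact hu (hb.traceMul_comp (F := F) h.1 hα u (h0 u))

/-- The case where `σ` acts nontrivially on `F`. -/
theorem IsHermitianForm.traceMul_of_ne_refl [Nontrivial V] [Module F V]
    [IsScalarTower F K V] (hτ : ∀ x, algebraMap F K (τ x) = σ (algebraMap F K x))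
    (h : IsHermitianForm σ β) (hb : FormNondegenerate β) (hα : α ≠ 0) (hτ1 : τ ≠ RingEquiv.refl F) :
    (IsUnitaryType (fun x y => traceMul F α (β x y)) (finrank F V) ↔ σ α = α) ∧
      (IsAtypicalForm (fun x y => traceMul F α (β x y)) ↔ σ α ≠ α) := by
  have hses := h.1.traceMul_comp hτ α
  obtain ⟨x, y, hxy⟩ := h.exists_traceMul_ne_zero (F := F) hb hα
  have hττ : ∀ a, τ (τ a) = a := fun a => (algebraMap F K).injective (by rw [hτ, hτ, h.2.2.1])
  have hherm : (∃ σ' : F ≃+* F, IsHermitianForm σ' (fun x y => traceMul F α (β x y))) ↔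
      σ α = α := by
    rw [← h.traceMul_symm_iff hτ hb]
    constructor
    · rintro ⟨σ', hσ'⟩
      rw [hses.unique hσ'.1 hxy]
      exact hσ'.2.2.2
    · exact fun hs => ⟨τ, hses, hτ1, hττ, hs⟩
  refine ⟨⟨fun hu => hherm.1 hu.1, fun hs => ⟨hherm.2 hs, hb.traceMul_comp h.1 hα, rfl⟩⟩,
    fun ha hs => ha.2.2.2 (hherm.2 hs), fun hs => ⟨⟨τ, hses⟩, fun ha => ?_, fun ha => ?_,
    fun hh => hs (hherm.1 hh)⟩⟩
  · exact hτ1 (hses.unique ha.1 hxy)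
  · exact hτ1 (hses.unique ha.1 hxy)

end Sesquilinear

/-! ### The fixed field of the automorphism of a hermitian form -/

section FixedField

variable {K : Type*} [Field K]

/-- The fixed field of an automorphism. -/
def fixedSubfield (σ : K ≃+* K) : Subfield K := RingHom.eqLocusField (σ : K →+* K) (RingHom.id K)

variable {σ : K ≃+* K}

theorem mem_fixedSubfield {x : K} : x ∈ fixedSubfield σ ↔ σ x = x := Iff.rfl

theorem finrank_fixedSubfield (hσ : σ ≠ RingEquiv.refl K) (h : ∀ x, σ (σ x) = x) :
    finrank (fixedSubfield σ) K = 2 := by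
  obtain ⟨y, hy⟩ : ∃ y, σ y ≠ y := by
    by_contra! h0
    exact hσ (RingEquiv.ext h0)
  have hy' : y - σ y ≠ 0 := sub_ne_zero.2 hy.symm
  have hli : LinearIndependent (fixedSubfield σ) ![1, y] := by
    refine LinearIndependent.pair_iff.2 fun a b hab => ?_
    have h1 : (a : K) + b * y = 0 := by simpa [Subfield.smul_def] using hab
    have h2 : (a : K) + b * σ y = 0 := by
      have := congrArg σ h1
      rwa [map_add, map_mul, mem_fixedSubfield.1 a.2, mem_fixedSubfield.1 b.2, map_zero] at this
    have hb : (b : K) = 0 := by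
      have h3 : (b : K) * (y - σ y) = 0 := by linear_combination h1 - h2
      exact (mul_eq_zero.1 h3).resolve_right hy'
    refine ⟨Subtype.ext ?_, Subtype.ext hb⟩
    simpa [hb] using h1
  have hspan : ⊤ ≤ Submodule.span (fixedSubfield σ) (Set.range ![1, y]) := by
    intro x _
    have hb : (x - σ x) / (y - σ y) ∈ fixedSubfield σ := by
      rw [mem_fixedSubfield, map_div₀, map_sub, map_sub, h, h, ← neg_sub x, ← neg_sub y,
        neg_div_neg_eq]
    have ha : x - (x - σ x) / (y - σ y) * y ∈ fixedSubfield σ := by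
      rw [mem_fixedSubfield, map_sub, map_mul, mem_fixedSubfield.1 hb]
      field_simp
      ring
    have hx : x = (⟨_, ha⟩ : fixedSubfield σ) • (1 : K) + (⟨_, hb⟩ : fixedSubfield σ) • y := by
      simp [Subfield.smul_def]
    rw [hx]
    exact Submodule.add_mem _ (Submodule.smul_mem _ _ (Submodule.subset_span ⟨0, rfl⟩))
      (Submodule.smul_mem _ _ (Submodule.subset_span ⟨1, rfl⟩))
  rw [finrank_eq_card_basis (Basis.mk hli hspan), Fintype.card_fin]

theorem natCard_fixedSubfield [Finite K] (hσ : σ ≠ RingEquiv.refl K) (h : ∀ x, σ (σ x) = x) :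
    Nat.card (fixedSubfield σ) ^ 2 = Nat.card K :=
  (natCard_eq_sq_of_finrank_eq_two (finrank_fixedSubfield hσ h)).symm

/-- An involution is the power of the Frobenius map that generates the Galois group over its
fixed field. -/
theorem apply_eq_pow_natCard_fixedSubfield [Finite K] (h : ∀ x, σ (σ x) = x) (x : K) :
    σ x = x ^ Nat.card (fixedSubfield σ) := by
  set s := Nat.card (fixedSubfield σ) with hs
  have hE : ∀ z, z ∈ fixedSubfield σ ↔ z ^ s = z := fun z => (fixedSubfield σ).mem_iff_pow_natCard
  have hadd : (x + σ x) ^ s = x + σ x := (hE _).1 (by rw [mem_fixedSubfield, map_add, h, add_comm])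
  have hmul : (x * σ x) ^ s = x * σ x := (hE _).1 (by rw [mem_fixedSubfield, map_mul, h, mul_comm])
  rw [hs, add_pow_natCard (fixedSubfield σ), ← hs] at hadd
  rw [mul_pow] at hmul
  -- `x ^ s` is a root of `(X - x) (X - σ x)`
  have h0 : (x ^ s - x) * (x ^ s - σ x) = 0 := by
    linear_combination (x ^ s) * hadd - hmul
  rcases mul_eq_zero.1 h0 with h1 | h1
  · rw [sub_eq_zero] at h1
    rw [h1, mem_fixedSubfield.1 ((hE x).2 h1)]
  · exact (sub_eq_zero.1 h1).symm

variable {F : Type*} [Field F] [Finite K] [Algebra F K]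

theorem natCard_fixedSubfield_of_even (hσ : σ ≠ RingEquiv.refl K) (h : ∀ x, σ (σ x) = x)
    (hw : Even (finrank F K)) :
    Nat.card (fixedSubfield σ) = Nat.card F ^ (finrank F K / 2) := by
  obtain ⟨r, hr⟩ := hw
  have h1 := natCard_fixedSubfield hσ h
  rw [natCard_eq_pow_finrank (K := F) (V := K), hr, ← two_mul, mul_comm 2 r, pow_mul] at h1
  rw [hr, show (r + r) / 2 = r by omega]
  exact Nat.pow_left_injective two_ne_zero h1

theorem restrict_eq_refl_iff (hσ : σ ≠ RingEquiv.refl K) (h : ∀ x, σ (σ x) = x) {τ : F ≃+* F}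
    (hτ : ∀ x, algebraMap F K (τ x) = σ (algebraMap F K x)) :
    τ = RingEquiv.refl F ↔ Even (finrank F K) := by
  have : Finite F := Finite.of_injective _ (algebraMap F K).injective
  constructor
  · rintro rfl
    let E : IntermediateField F K := (fixedSubfield σ).toIntermediateField fun x => (hτ x).symm
    have h1 : finrank E K = 2 := finrank_fixedSubfield hσ h
    rw [← finrank_mul_finrank F E K, h1]
    exact even_two.mul_left _
  · intro hw
    obtain ⟨E, hE, -, -⟩ := exists_intermediateField_of_natCard hw _
      (natCard_fixedSubfield_of_even hσ h hw)
    ext x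
    refine (algebraMap F K).injective ?_
    rw [hτ]
    have : algebraMap F K x ∈ fixedSubfield σ := hE ▸ E.algebraMap_mem x
    exact this

end FixedField

/-! ### The trace form of a hermitian form over the fixed field -/

section HermitianDiagonal

variable {E K V : Type*} [Field E] [Field K] [Algebra E K] [AddCommGroup V] [Module K V]
  [Module E V] [IsScalarTower E K V] {σ : K ≃+* K} {β : V → V → K}

/-- The values `β(v, v)` of a hermitian form are fixed by `σ`; over the fixed field `E` they form
a quadratic form whose polar form is `Tr β(x, y)`. -/
theorem IsHermitianForm.exists_diagonal (h : IsHermitianForm σ β)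
    (hE : ∀ x, σ x = x ↔ ∃ e, algebraMap E K e = x)
    (htr : ∀ x, algebraMap E K (Algebra.trace E K x) = x + σ x) :
    ∃ H : QuadraticForm E V, (∀ v, algebraMap E K (H v) = β v v) ∧
      ∀ x y, QuadraticMap.polar H x y = Algebra.trace E K (β x y) := by
  have hinj := (algebraMap E K).injective
  have hfix : ∀ e, σ (algebraMap E K e) = algebraMap E K e := fun e => (hE _).2 ⟨e, rfl⟩
  have hsm : ∀ (c : E) (v : V), c • v = algebraMap E K c • v := fun c v =>
    (algebraMap_smul K c v).symm
  have hH : ∀ v, ∃ e, algebraMap E K e = β v v := fun v => (hE _).1 (h.2.2.2 v v).symm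
  choose H hH using hH
  let B : LinearMap.BilinForm E V := LinearMap.mk₂ E (fun x y => Algebra.trace E K (β x y))
    (fun x y z => by rw [h.1.add_left, map_add])
    (fun c x y => by rw [hsm, h.1.smul_left, ← Algebra.smul_def, map_smul])
    (fun x y z => by rw [h.1.add_right, map_add])
    (fun c x y => by rw [hsm, h.1.smul_right, hfix, ← Algebra.smul_def, map_smul])
  have hadd : ∀ x y, H (x + y) = H x + H y + B x y := fun x y => hinj (by
    rw [map_add, map_add, hH, hH, hH, LinearMap.mk₂_apply, htr, ← h.2.2.2, h.1.add_left,
      h.1.add_right, h.1.add_right]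
    ring)
  refine ⟨⟨H, fun a x => hinj ?_, B, hadd⟩, hH, fun x y => ?_⟩
  · rw [hH, hsm, h.1.smul_left, h.1.smul_right, hfix, smul_eq_mul, map_mul, map_mul, hH]
    ring
  · change H (x + y) - H x - H y = _
    rw [hadd, LinearMap.mk₂_apply]
    ring

variable [Finite K] [FiniteDimensional K V]

/-- Let `W` be a maximal totally isotropic `K`-subspace. A complement of `W` in `W^⊥` is
anisotropic for the form `v ↦ β(v, v)` over `E`, so it has `E`-dimension at most 2, that is,
`K`-dimension at most 1. The parity of `dim_K V` decides between 0 and 1. -/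
theorem IsHermitianForm.diagonal_type (h : IsHermitianForm σ β) (hb : FormNondegenerate β)
    (hw : finrank E K = 2) {H : QuadraticForm E V} (hH : ∀ v, algebraMap E K (H v) = β v v)
    (hpol : ∀ x y, QuadraticMap.polar H x y = Algebra.trace E K (β x y)) :
    (Even (finrank K V) → IsOPlus H (finrank K V * 2)) ∧
      (Odd (finrank K V) → IsOMinus H (finrank K V * 2)) := by
  have : Finite E := Finite.of_injective _ (algebraMap E K).injective
  have : Finite V := Module.finite_of_finite K
  have := Fintype.ofFinite V
  have : FiniteDimensional E V := Module.Finite.trans K V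
  have htr : Algebra.trace E K ≠ 0 := Algebra.trace_ne_zero E K
  have hdim := finrank_mul_finrank E K V
  have hnd : FormNondegenerate (QuadraticMap.polar H) := by
    intro u hu
    refine hb u fun v => eq_zero_of_forall_map_mul_eq_zero htr fun c => ?_
    have := hu (σ.symm c • v)
    rwa [hpol, h.1.smul_right, RingEquiv.apply_symm_apply] at this
  have hH0 : ∀ v, H v = 0 ↔ β v v = 0 := fun v => by rw [← hH, map_eq_zero (algebraMap E K)]
  obtain ⟨W, hW, hmax⟩ := (wellFounded_gt (α := Submodule K V)).has_min
    {W : Submodule K V | IsTotallySingular H (W.restrictScalars E)}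
    ⟨⊥, fun v hv => by
      rw [Submodule.restrictScalars_mem, Submodule.mem_bot] at hv
      rw [hv, QuadraticMap.map_zero]⟩
  change IsTotallySingular H (W.restrictScalars E) at hW
  let P : Submodule K V :=
    { carrier := {v | ∀ w ∈ W, β w v = 0}
      zero_mem' := fun w _ => by simpa using h.1.smul_right 0 w 0
      add_mem' := fun hx hy w hw => by rw [h.1.add_right, hx w hw, hy w hw, add_zero]
      smul_mem' := fun c x hx w hw => by rw [h.1.smul_right, hx w hw, mul_zero] }
  have hP : polarPerp H (W.restrictScalars E) = P.restrictScalars E := by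
    ext v
    rw [mem_polarPerp]
    simp only [hpol, Submodule.restrictScalars_mem]
    refine ⟨fun hv w hw => eq_zero_of_forall_map_mul_eq_zero htr fun c => ?_, fun hv w hw => ?_⟩
    · simpa [h.1.smul_left] using hv (c • w) (W.smul_mem c hw)
    · rw [show β w v = 0 from hv w hw, map_zero]
  have hWP : W ≤ P := fun w hw => by
    have := hW.le_polarPerp hw
    rwa [hP] at this
  have hsing : ∀ v ∈ P, H v = 0 → v ∈ W := by
    intro v hv h0
    have hts : IsTotallySingular H ((W ⊔ Submodule.span K {v}).restrictScalars E) := by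
      intro x hx
      obtain ⟨w, hwW, y, hy, rfl⟩ := Submodule.mem_sup.1 hx
      obtain ⟨c, rfl⟩ := Submodule.mem_span_singleton.1 hy
      rw [map_add_eq_of_polar_eq_zero (by
        rw [hpol, show β w (c • v) = 0 from P.smul_mem c hv w hwW, map_zero]), hW w hwW, zero_add,
        hH0, h.1.smul_left, h.1.smul_right, (hH0 v).1 h0, mul_zero, mul_zero]
    have hnlt := hmax _ hts
    have heq : W = W ⊔ Submodule.span K {v} :=
      le_sup_left.eq_of_not_lt hnlt
    rw [heq]
    exact Submodule.mem_sup_right (Submodule.mem_span_singleton_self v)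
  obtain ⟨C, hC⟩ := exists_isCompl (W.comap P.subtype)
  have hCa : ∀ u ∈ (C.map P.subtype).restrictScalars E, H u = 0 → u = 0 := by
    intro u hu h0
    obtain ⟨u, huC, rfl⟩ := hu
    have huW : u ∈ W.comap P.subtype := hsing _ u.2 h0
    simp [Submodule.disjoint_def.1 hC.disjoint u huW huC]
  have h1 := finrank_le_two_of_anisotropic hCa
  rw [finrank_restrictScalars_submodule, hw, Submodule.finrank_map_subtype_eq] at h1
  have h2 := Submodule.finrank_add_eq_of_isCompl hC
  rw [LinearEquiv.finrank_eq (Submodule.comapSubtypeEquivOfLe hWP)] at h2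
  have h3 := hW.finrank_polarPerp (radical_eq_bot_of_polar_nondegenerate hnd)
  rw [hP, finrank_restrictScalars_submodule, finrank_restrictScalars_submodule, hw] at h3
  have h4 := finrank_restrictScalars_submodule (F := E) W
  rw [hw] at hdim h4
  rw [mul_comm, hdim]
  constructor
  · rintro ⟨r, hr⟩
    exact isOPlus_of_isTotallySingular (radical_eq_bot_of_polar_nondegenerate hnd) hW (by omega)
  · rintro ⟨r, hr⟩
    exact hW.isOMinus hnd (by omega) fun v hv h0 => hsing v (by rwa [hP] at hv) h0

end HermitianDiagonal

/-! ### Hermitian forms in even degree -/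

section HermitianEven

variable {F K V : Type*} [Field F] [Field K] [Finite K] [Algebra F K] [AddCommGroup V]
  [Module K V] {σ : K ≃+* K} {β : V → V → K} {α : K}

theorem IsHermitianForm.exists_fixedField (h : IsHermitianForm σ β) (hw : Even (finrank F K)) :
    ∃ E : IntermediateField F K, finrank E K = 2 ∧
      (∀ x, σ x = x ↔ ∃ e, algebraMap E K e = x) ∧
      (∀ x, algebraMap E K (Algebra.trace E K x) = x + σ x) ∧ ∀ x : F, σ (algebraMap F K x) =
        algebraMap F K x := by
  have : Finite F := Finite.of_injective _ (algebraMap F K).injective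
  have hcard := natCard_fixedSubfield_of_even h.2.1 h.2.2.1 hw
  obtain ⟨E, hE, hK, -⟩ := exists_intermediateField_of_natCard hw _ hcard
  have hmem : ∀ x, x ∈ E ↔ σ x = x := fun x => by
    rw [← mem_fixedSubfield, ← hE]
    rfl
  refine ⟨E, hK, fun x => ?_, fun x => ?_, fun x => (hmem _).1 (E.algebraMap_mem x)⟩
  · rw [← hmem]
    exact ⟨fun hx => ⟨⟨x, hx⟩, rfl⟩, fun ⟨e, he⟩ => he ▸ e.2⟩
  · rw [algebraMap_trace_of_finrank_eq_two hK, apply_eq_pow_natCard_fixedSubfield h.2.2.1, ← hE]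
    rfl

variable [Module F V] [IsScalarTower F K V]

theorem IsHermitianForm.isSesquilinear_refl_of_even (h : IsHermitianForm σ β)
    (hw : Even (finrank F K)) :
    IsSesquilinear (RingEquiv.refl F) (fun x y => traceMul F α (β x y)) := by
  obtain ⟨E, -, -, -, hF⟩ := h.exists_fixedField hw
  exact h.1.traceMul_comp (fun x => (hF x).symm) α

theorem IsHermitianForm.isSymmetricForm_iff_of_even [Nontrivial V] (h : IsHermitianForm σ β)
    (hb : FormNondegenerate β) (hw : Even (finrank F K)) :
    IsSymmetricForm (fun x y => traceMul F α (β x y)) ↔ σ α = α := by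
  obtain ⟨E, -, -, -, hF⟩ := h.exists_fixedField hw
  rw [← h.traceMul_symm_iff (τ := RingEquiv.refl F) (fun x => (hF x).symm) hb]
  exact ⟨fun hs => hs.2, fun hs => ⟨h.isSesquilinear_refl_of_even hw, hs⟩⟩

theorem IsHermitianForm.isAlternatingForm_iff_of_even [Nontrivial V] (h : IsHermitianForm σ β)
    (hb : FormNondegenerate β) (hw : Even (finrank F K)) :
    IsAlternatingForm (fun x y => traceMul F α (β x y)) ↔ σ α = -α := by
  obtain ⟨E, hK, hE, htr, hF⟩ := h.exists_fixedField hw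
  constructor
  · intro ha
    have := (h.traceMul_eq_iff (α := α) (τ := RingEquiv.refl F) (fun x => (hF x).symm) hb (-1)).1
      fun x y => by rw [neg_one_mul]; exact ha.neg x y
    rw [map_neg, map_one, neg_one_mul] at this
    linear_combination this
  · intro hs
    refine ⟨h.isSesquilinear_refl_of_even hw, fun x => ?_⟩
    have h0 : traceMul E α (β x x) = 0 := by
      refine (algebraMap E K).injective ?_
      rw [traceMul_apply, htr, map_mul, hs, ← h.2.2.2, map_zero]
      ring
    exact (traceMul_tower (F := F) (E := E) α _).trans (by rw [h0, map_zero])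

theorem IsHermitianForm.isSymplecticType_iff_of_even [Nontrivial V] (h : IsHermitianForm σ β)
    (hb : FormNondegenerate β) (hα : α ≠ 0) (hw : Even (finrank F K)) :
    IsSymplecticType (fun x y => traceMul F α (β x y)) (finrank F V) ↔ σ α = -α := by
  rw [← h.isAlternatingForm_iff_of_even hb hw]
  exact ⟨fun hs => hs.1, fun hs => ⟨hs, hb.traceMul_comp h.1 hα, rfl⟩⟩

theorem IsHermitianForm.isAtypicalForm_iff_of_even [Nontrivial V] (h : IsHermitianForm σ β)
    (hb : FormNondegenerate β) (hα : α ≠ 0) (hw : Even (finrank F K)) :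
    IsAtypicalForm (fun x y => traceMul F α (β x y)) ↔ σ α ≠ α ∧ σ α ≠ -α := by
  have hses := h.isSesquilinear_refl_of_even (α := α) hw
  obtain ⟨x, y, hxy⟩ := h.exists_traceMul_ne_zero (F := F) hb hα
  have hnh : ¬ ∃ σ' : F ≃+* F, IsHermitianForm σ' (fun x y => traceMul F α (β x y)) := by
    rintro ⟨σ', hσ'⟩
    exact hσ'.2.1 (hσ'.1.unique hses hxy)
  rw [Ne, Ne, ← h.isAlternatingForm_iff_of_even (F := F) hb hw,
    ← h.isSymmetricForm_iff_of_even (F := F) hb hw]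
  exact ⟨fun ha => ⟨ha.2.2.1, ha.2.1⟩, fun ha => ⟨⟨_, hses⟩, ha.2, ha.1, hnh⟩⟩

variable [FiniteDimensional K V]

/-- If `α` is fixed by `σ`, the quadratic form of `(x, y) ↦ Tr (α β(x, y))` is the transfer from
the fixed field to `F` of `v ↦ α β(v, v)`; the factor `1/2` cancels against the trace of `K`
over the fixed field. -/
theorem IsHermitianForm.exists_halfDiagonal_of_even (h : IsHermitianForm σ β)
    (hb : FormNondegenerate β) (hα : α ≠ 0) (hw : Even (finrank F K)) (h2 : (2 : F) ≠ 0)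
    (hs : σ α = α) :
    ∃ T : QuadraticForm F V, IsHalfDiagonal (fun x y => traceMul F α (β x y)) T ∧
      (Even (finrank K V) → IsOPlus T (finrank K V * finrank F K)) ∧
      (Odd (finrank K V) → IsOMinus T (finrank K V * finrank F K)) := by
  have : Finite F := Finite.of_injective _ (algebraMap F K).injective
  obtain ⟨E, hK, hE, htr, -⟩ := h.exists_fixedField hw
  have := isScalarTower_intermediateField (V := V) E
  have : FiniteDimensional E V := Module.Finite.trans K V
  obtain ⟨H, hH, hpol⟩ := h.exists_diagonal hE htr
  obtain ⟨hplus, hminus⟩ := h.diagonal_type hb hK hH hpol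
  obtain ⟨a, rfl⟩ := (hE α).1 hs
  have hL : traceMul F a ≠ 0 := traceMul_ne_zero (by rintro rfl; exact hα (map_zero _))
  have hn : finrank K V * finrank F K = finrank K V * 2 * finrank F E := by
    rw [← finrank_mul_finrank F E K, hK]
    ring
  refine ⟨(traceMul F a).compQuadraticMap' H, ⟨h2, fun v => ?_⟩, ?_, ?_⟩
  · change _ = (2 : F)⁻¹ * traceMul F (algebraMap E K a) (β v v)
    rw [traceMul_tower (F := F) (E := E), ← hH, traceMul_apply, ← map_mul,
      Algebra.trace_algebraMap, hK, LinearMap.compQuadraticMap'_apply, traceMul_apply, map_nsmul,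
      nsmul_eq_mul, Nat.cast_ofNat, inv_mul_cancel_left₀ h2]
  · exact fun hA => hn ▸ (hplus hA).compQuadraticMap' hL
  · exact fun hA => hn ▸ (hminus hA).compQuadraticMap' hL

theorem IsHalfDiagonal.unique {k V : Type*} [Field k] [AddCommGroup V] [Module k V]
    {b : V → V → k} {Q Q' : QuadraticForm k V} (h : IsHalfDiagonal b Q)
    (h' : IsHalfDiagonal b Q') : Q = Q' := by
  ext v
  rw [h.2, h'.2]

theorem IsHermitianForm.isOPlusForm_isOMinusForm_iff_of_even [Nontrivial V]
    (h : IsHermitianForm σ β) (hb : FormNondegenerate β) (hα : α ≠ 0) (hw : Even (finrank F K))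
    (h2 : (2 : F) ≠ 0) :
    (IsOPlusForm (fun x y => traceMul F α (β x y)) (finrank K V * finrank F K) ↔
      Even (finrank K V) ∧ σ α = α) ∧
    (IsOMinusForm (fun x y => traceMul F α (β x y)) (finrank K V * finrank F K) ↔
      Odd (finrank K V) ∧ σ α = α) := by
  rw [IsOPlusForm, IsOMinusForm, h.isSymmetricForm_iff_of_even hb hw]
  refine ⟨⟨fun ⟨hs, Q, hQ, ht⟩ => ?_, fun ⟨hA, hs⟩ => ?_⟩,
    ⟨fun ⟨hs, Q, hQ, ht⟩ => ?_, fun ⟨hA, hs⟩ => ?_⟩⟩ <;>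
  obtain ⟨T, hT, hplus, hminus⟩ := h.exists_halfDiagonal_of_even hb hα hw h2 hs
  · rw [hQ.unique hT] at ht
    refine ⟨?_, hs⟩
    by_contra hA
    exact ht.not_isOMinus (hminus (Nat.not_even_iff_odd.1 hA))
  · exact ⟨hs, T, hT, hplus hA⟩
  · rw [hQ.unique hT] at ht
    refine ⟨?_, hs⟩
    by_contra hA
    exact (hplus (Nat.not_odd_iff_even.1 hA)).not_isOMinus ht
  · exact ⟨hs, T, hT, hminus hA⟩

end HermitianEven

/-! ### Symmetric, alternating and pseudo-symplectic forms -/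

section Bilinear

variable {F K V : Type*} [Field F] [Field K] [Algebra F K] [AddCommGroup V] [Module K V]
  {β : V → V → K}

theorem IsSymmetricForm.exists_halfDiagonal (h : IsSymmetricForm β) (h2 : (2 : K) ≠ 0) :
    ∃ Q : QuadraticForm K V, IsHalfDiagonal β Q ∧ ∀ x y, QuadraticMap.polar Q x y = β x y := by
  let B : LinearMap.BilinForm K V := LinearMap.mk₂ K β h.1.add_left h.1.smul_left h.1.add_right
    h.1.smul_right
  have hQ : ∀ v, ((2 : K)⁻¹ • B.toQuadraticMap) v = (2 : K)⁻¹ * β v v := fun _ => rfl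
  refine ⟨(2 : K)⁻¹ • B.toQuadraticMap, ⟨h2, hQ⟩, fun x y => ?_⟩
  rw [QuadraticMap.polar, hQ, hQ, hQ, h.1.add_left, h.1.add_right, h.1.add_right, h.2 y x]
  field_simp
  ring

variable [Module F V] [IsScalarTower F K V]

theorem IsSymmetricForm.traceMul_comp (h : IsSymmetricForm β) (α : K) :
    IsSymmetricForm (fun x y => traceMul F α (β x y)) :=
  ⟨h.1.traceMul_comp (fun _ => rfl) α, fun x y => congrArg (traceMul F α) (h.2 x y)⟩

theorem IsHalfDiagonal.compQuadraticMap' {Q : QuadraticForm K V} (h : IsHalfDiagonal β Q)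
    (L : K →ₗ[F] F) : IsHalfDiagonal (fun x y => L (β x y)) (L.compQuadraticMap' Q) := by
  have h2 : algebraMap F K 2 = 2 := map_ofNat _ 2
  refine ⟨fun h0 => h.1 (by rw [← h2, h0, map_zero]), fun v => ?_⟩
  rw [LinearMap.compQuadraticMap'_apply, h.2, ← h2, ← map_inv₀, ← Algebra.smul_def, map_smul,
    smul_eq_mul]

variable [Finite K] {α : K}

theorem IsSymplecticType.traceMul_comp {n : ℕ} (h : IsSymplecticType β n) (hα : α ≠ 0) :
    IsSymplecticType (fun x y => traceMul F α (β x y)) (finrank F V) :=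
  ⟨⟨h.1.1.traceMul_comp (fun _ => rfl) α, fun x =>
    (congrArg (traceMul F α) (h.1.2 x)).trans (map_zero _)⟩,
    h.2.1.traceMul_comp h.1.1 hα, rfl⟩

/-- The diagonal `β(v, v)` takes every value, since in characteristic 2 every scalar is a
square. -/
theorem IsPseudoSymplecticType.traceMul_comp {n : ℕ} (h : IsPseudoSymplecticType β n)
    (hα : α ≠ 0) : IsPseudoSymplecticType (fun x y => traceMul F α (β x y)) (finrank F V) := by
  obtain ⟨h2, hsym, halt, hnd, -⟩ := h
  refine ⟨(algebraMap F K).injective (by rw [map_ofNat, h2, map_zero]), hsym.traceMul_comp α,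
    fun ha => ?_, hnd.traceMul_comp hsym.1 hα, rfl⟩
  obtain ⟨v, hv⟩ : ∃ v, β v v ≠ 0 := by
    by_contra! h0
    exact halt ⟨hsym.1, h0⟩
  refine traceMul_ne_zero (F := F) hα (LinearMap.ext fun c => ?_)
  obtain ⟨d, hd⟩ := isSquare_of_two_eq_zero h2 (c / β v v)
  have : traceMul F α (β (d • v) (d • v)) = 0 := ha.2 (d • v)
  rwa [hsym.1.smul_left, hsym.1.smul_right, RingEquiv.refl_apply, ← mul_assoc, ← hd,
    div_mul_cancel₀ c hv] at this

end Bilinear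

theorem theoremC {F K V : Type*} [Field F] [Finite F] [Field K] [Finite K] [Algebra F K]
    [AddCommGroup V] [Module K V] [Module F V] [IsScalarTower F K V] [FiniteDimensional K V]
    (q w A : ℕ) (hq : Nat.card F = q) (hw : finrank F K = w) (hA : finrank K V = A)
    (hA0 : 0 < A) (α : K) (hα : α ≠ 0) :
    -- quadratic forms
    (∀ Q : QuadraticForm K V,
      QuadraticClassification q w A α Q ((traceMul F α).compQuadraticMap' Q)) ∧
    -- isometries of a form are isometries of the composed form
    (∀ β : V → V → K,
      (isomForm β).map (restrictGL F K V) ≤ isomForm (fun x y => traceMul F α (β x y))) ∧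
    -- symmetric forms, odd characteristic
    (∀ β : V → V → K, IsSymmetricForm β → FormNondegenerate β → Odd q →
      IsSymmetricForm (fun x y => traceMul F α (β x y)) ∧
      ∃ (Q : QuadraticForm K V) (T : QuadraticForm F V),
        IsHalfDiagonal β Q ∧ IsHalfDiagonal (fun x y => traceMul F α (β x y)) T ∧
        Q.radical = ⊥ ∧ QuadraticClassification q w A α Q T) ∧
    -- hermitian forms
    (∀ (σ : K ≃+* K) (β : V → V → K), IsHermitianForm σ β → FormNondegenerate β →
      (Odd w →
        (IsUnitaryType (fun x y => traceMul F α (β x y)) (A * w) ↔ σ α = α) ∧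
        (IsAtypicalForm (fun x y => traceMul F α (β x y)) ↔ σ α ≠ α)) ∧
      (Even w → Even q →
        (IsSymplecticType (fun x y => traceMul F α (β x y)) (A * w) ↔ σ α = α)) ∧
      (Even w → Odd q →
        (IsSymplecticType (fun x y => traceMul F α (β x y)) (A * w) ↔ σ α = -α)) ∧
      (Even w →
        (IsAtypicalForm (fun x y => traceMul F α (β x y)) ↔ σ α ≠ α ∧ σ α ≠ -α)) ∧
      (Even w → Odd q →
        (IsOPlusForm (fun x y => traceMul F α (β x y)) (A * w) ↔ Even A ∧ σ α = α)) ∧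
      (Even w → Odd q →
        (IsOMinusForm (fun x y => traceMul F α (β x y)) (A * w) ↔ Odd A ∧ σ α = α))) ∧
    -- alternating forms
    (∀ β : V → V → K, IsSymplecticType β A →
      IsSymplecticType (fun x y => traceMul F α (β x y)) (A * w)) ∧
    -- pseudo-symplectic forms
    (∀ β : V → V → K, Even q → IsPseudoSymplecticType β A →
      IsPseudoSymplecticType (fun x y => traceMul F α (β x y)) (A * w)) := by
  subst hq hw hA
  have hn : finrank K V * finrank F K = finrank F V := by rw [mul_comm, finrank_mul_finrank]
  have : Nontrivial V := nontrivial_of_finrank_pos hA0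
  have h2iff : (2 : F) = 0 ↔ (2 : K) = 0 := by
    rw [← map_ofNat (algebraMap F K) 2, map_eq_zero]
  refine ⟨quadraticClassification hα, isomForm_map_restrictGL_le _, fun β hs hb hq => ?_,
    fun σ β h hb => ⟨fun hw => ?_, fun hw hq => ?_, fun hw _ => ?_,
      h.isAtypicalForm_iff_of_even hb hα, fun hw hq => ?_, fun hw hq => ?_⟩,
    fun β h => hn ▸ h.traceMul_comp hα, fun β _ h => hn ▸ h.traceMul_comp hα⟩
  · have h2 : (2 : K) ≠ 0 := fun h0 => natCard_odd_iff_two_ne_zero.1 hq (h2iff.2 h0)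
    obtain ⟨Q, hQ, hpol⟩ := hs.exists_halfDiagonal h2
    refine ⟨hs.traceMul_comp α, Q, _, hQ, hQ.compQuadraticMap' _,
      radical_eq_bot_of_polar_nondegenerate fun u hu => hb u fun v => ?_,
      quadraticClassification hα Q⟩
    rw [← hpol, hu]
  · obtain ⟨τ, hτ⟩ := exists_ringEquiv_restrict F σ
    rw [hn]
    exact h.traceMul_of_ne_refl hτ hb hα fun h1 =>
      Nat.not_even_iff_odd.2 hw ((restrict_eq_refl_iff h.2.1 h.2.2.1 hτ).1 h1)
  · have h2 : (2 : K) = 0 := by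
      rw [← h2iff]
      by_contra h2
      exact Nat.not_even_iff_odd.2 (natCard_odd_iff_two_ne_zero.2 h2) hq
    have hneg : -α = α := by linear_combination -α * h2
    rw [hn, h.isSymplecticType_iff_of_even hb hα hw, hneg]
  · rw [hn, h.isSymplecticType_iff_of_even hb hα hw]
  · exact (h.isOPlusForm_isOMinusForm_iff_of_even hb hα hw (natCard_odd_iff_two_ne_zero.1 hq)).1
  · exact (h.isOPlusForm_isOMinusForm_iff_of_even hb hα hw (natCard_odd_iff_two_ne_zero.1 hq)).2
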